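/- Let $u:\mathbb{R}^2\to[0,\infty)$ be a global classical solution of the one-phase free boundary problem: $u$ is continuous; with $\Omega:=\{u>0\}$, its free boundary $F(u):=\partial\Omega$ is a smooth embedded curve (possibly with several components) that locally has $u>0$ on one side and $u=0$ on the other; $u$ is harmonic in $\Omega$ and $u\in C^\infty(\overline{\Omega})$; and $|\nabla u|=1$ on $F(u)$, with the gradient taken from the side of $\Omega$. Let $\nu=-\nabla u$ be the unit normal of $F(u)$ pointing out of $\Omega$, and let $H=\operatorname{div}(\nabla u/|\nabla u|)$ be the curvature of $F(u)$ with respect to $\nu$ (so that $H=1/r$ when $\{u=0\}$ is a disk of radius $r$). Set \[ Q(\phi,\psi):=\int_{\Omega}\nabla\phi\cdot\nabla\psi\,dx-\int_{F(u)}H\,\phi\,\psi\,d\mathcal{H}^1,\qquad \phi,\psi\in C_c^\infty(\overline{\Omega}), \] where $C_c^\infty(\overline{\Omega})$ is the space of functions that are smooth up to the boundary of $\Omega$ and have compact support in $\overline{\Omega}$, and define the Morse index of $u$ by \[ \operatorname{ind}(u):=\sup\{\dim V:\ V\subseteq C_c^\infty(\overline{\Omega})\text{ is a subspace on which } Q \text{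 is negative definite}\}. \] If $\Omega$ is (non-empty and) connected and $\operatorname{ind}(u)<\infty$, then $u$ has finite topology, that is, $F(u)$ has finitely many connected components. -/

import Mathlib

open scoped ContDiff RealInnerProductSpace
open MeasureTheory

noncomputable section

namespace OnePhase

/-- The Euclidean plane. -/
abbrev Plane := EuclideanSpace ℝ (Fin 2)

/-- The positive phase `Ω = {u > 0}`. -/
def posPhase (u : Plane → ℝ) : Set Plane := {x | 0 < u x}

/-- The free boundary `F(u) = ∂{u > 0}`. -/
def freeBoundary (u : Plane → ℝ) : Set Plane := frontier (posPhase u)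

/-- `F(u)` is a smooth embedded curve with `u > 0` on one side and `u = 0` on the other: near each
of its points it is the zero set of a smooth function `g` without critical points, with `u > 0`
where `g > 0` and `u = 0` where `g < 0`. The sides orient `F(u)`. -/
def HasSmoothFreeBoundary (u : Plane → ℝ) : Prop :=
  ∀ p ∈ freeBoundary u, ∃ U : Set Plane, IsOpen U ∧ p ∈ U ∧ ∃ g : Plane → ℝ,
    ContDiffOn ℝ ∞ g U ∧ (∀ x ∈ U, fderiv ℝ g x ≠ 0) ∧
    (∀ x ∈ U, x ∈ freeBoundary u ↔ g x = 0) ∧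
    (∀ x ∈ U, 0 < g x → 0 < u x) ∧
    (∀ x ∈ U, g x < 0 → u x = 0)

/-- The gradient of `u` on the closure of the positive phase; at points of the free boundary it is
the gradient from the positive side. -/
def gradPos (u : Plane → ℝ) (x : Plane) : Plane :=
  gradientWithin u (closure (posPhase u)) x

/-- Global classical solutions of the one-phase free boundary problem in the plane. -/
structure IsClassicalSolution (u : Plane → ℝ) : Prop where
  nonneg : ∀ x, 0 ≤ u x
  continuous : Continuous u
  smooth_freeBoundary : HasSmoothFreeBoundary u
  smooth_up_to_boundary : ContDiffOn ℝ ∞ u (closure (posPhase u))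
  harmonic : InnerProductSpace.HarmonicOnNhd u (posPhase u)
  norm_grad_eq_one : ∀ p ∈ freeBoundary u, ‖gradPos u p‖ = 1

/-- The extension `∇u / |∇u|` of the inner unit normal `-ν` of `F(u)` to a unit vector field on
the closure of the positive phase near `F(u)`. -/
def innerNormal (u : Plane → ℝ) (x : Plane) : Plane := ‖gradPos u x‖⁻¹ • gradPos u x

/-- The (mean) curvature of `F(u)` with respect to the outer unit normal `ν = -∇u`, that is
`H = - div ν = div (∇u / |∇u|)`, with derivatives taken from the positive side. It is positive
where `{u = 0}` is strictly convex: it is `1 / r` if `{u = 0}` is a disk of radius `r`. -/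
def meanCurvature (u : Plane → ℝ) (p : Plane) : ℝ :=
  ∑ i : Fin 2,
    (fderivWithin ℝ (innerNormal u) (closure (posPhase u)) p (EuclideanSpace.single i 1)) i

/-- The space `C_c^∞` of the closure of the positive phase: functions smooth up to the free
boundary and compactly supported in the closed set `Ω ∪ F(u)`. They are realized as functions on
the plane that vanish off `Ω ∪ F(u)`. -/
def testSpace (u : Plane → ℝ) : Submodule ℝ (Plane → ℝ) where
  carrier := {φ | ContDiffOn ℝ ∞ φ (closure (posPhase u)) ∧ HasCompactSupport φ ∧
    ∀ x, x ∉ closure (posPhase u) → φ x = 0}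
  add_mem' := by
    rintro φ ψ ⟨h1, h2, h3⟩ ⟨k1, k2, k3⟩
    exact ⟨h1.add k1, h2.add k2, fun x hx => by simp [h3 x hx, k3 x hx]⟩
  zero_mem' := ⟨contDiffOn_const, HasCompactSupport.zero, fun _ _ => rfl⟩
  smul_mem' := by
    rintro c φ ⟨h1, h2, h3⟩
    exact ⟨h1.const_smul c, h2.smul_left, fun x hx => by simp [h3 x hx]⟩

/-- The second variation form of the Alt-Caffarelli energy,
`Q(φ, ψ) = ∫_Ω ∇φ · ∇ψ dx - ∫_{F(u)} H φ ψ dℋ¹`. -/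
def secondVariation (u φ ψ : Plane → ℝ) : ℝ :=
  (∫ x in posPhase u, ⟪gradient φ x, gradient ψ x⟫) -
    ∫ x in freeBoundary u, meanCurvature u x * φ x * ψ x ∂(Measure.hausdorffMeasure 1)

/-- The second variation form is negative definite on `V`. -/
def IsNegDefOn (u : Plane → ℝ) (V : Submodule ℝ (Plane → ℝ)) : Prop :=
  ∀ φ ∈ V, φ ≠ 0 → secondVariation u φ φ < 0

/-- The Morse index of `u`: the supremum of the dimensions of the subspaces of the test space on
which the second variation form is negative definite. -/
def morseIndex (u : Plane → ℝ) : ℕ∞ :=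
  ⨆ (V : Submodule ℝ (Plane → ℝ)) (_ : V ≤ testSpace u) (_ : IsNegDefOn u V),
    Cardinal.toENat (Module.rank ℝ V)

/-- Finite topology: the free boundary has finitely many connected components. -/
def HasFiniteTopology (u : Plane → ℝ) : Prop :=
  Finite (ConnectedComponents (freeBoundary u))

end OnePhase

end

/-! The proof is by contradiction: if `F(u)` has infinitely many components, there are infinitely
many test functions with disjoint supports on which `Q` is negative. Such functions diagonalize `Q`,
so `Q` is negative definite on their infinite-dimensional span and the index is infinite
(`morseIndex_eq_top_of_diagonal`).

Sign of the curvature. The function `∂u/∂x - i ∂u/∂y` is holomorphic in `Ω` and has modulus one on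
`F(u)`. It is bounded, by Harnack's inequality, so a Phragmén–Lindelöf argument gives `|∇u| ≤ 1`
(`norm_gradPos_le_one`). Hence the normal derivative of `u` cannot increase on entering `Ω` from
`F(u)`, and since `u` is harmonic this says `H ≥ 0` (`meanCurvature_nonneg`).

A quantum of curvature. The normal turns with speed `H` along `F(u)`, so the total curvature of a
component bounds the oscillation of its normal (`edist_innerNormal_le`). If that total is below `1 /
8`, the normal stays close to one of the four axis directions `e`. The component is then closed and
locally a graph of bounded slope over the line orthogonal to `e`, so it contains an entire graph,
and the connected set `Ω` lies above that graph. Two such components with the same `e` would each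
lie above the graph in the other, so they coincide (`component_unique`). Thus at most four
components have total curvature below `1 / 8`. As only finitely many components meet a given ball,
infinitely many components leave curvature at least `1 / 8` outside every ball
(`le_lintegral_compl_ball`).

Logarithmic cutoffs. The plane is parabolic: a cutoff that rises and falls over logarithmic width
`L` has Dirichlet energy `O(1 / L)`, wherever it is placed (`exists_energy_bound`). Fix `L` so that
this energy is below `1 / 16`, and choose successive disjoint annuli on whose plateaus the curvature
is at least `1 / 16`. As `H ≥ 0`, the transition regions do no harm, and `Q` is negative on each
cutoff. -/

noncomputable section

namespace OnePhase

open Set Filter Topology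

/-! ### Coordinates in the plane -/

/-- Rotation of a vector of the plane by a right angle. -/
def rot (e : Plane) : Plane := !₂[-e 1, e 0]

/-- The point of the plane with coordinates `s` along `rot e` and `y` along `e`. -/
def planePt (e : Plane) (s y : ℝ) : Plane := s • rot e + y • e

lemma inner_eq_coord (x y : Plane) : ⟪x, y⟫ = x 0 * y 0 + x 1 * y 1 := by
  simp [PiLp.inner_apply, Fin.sum_univ_two, mul_comm]

lemma norm_sq_eq_coord (x : Plane) : ‖x‖ ^ 2 = x 0 ^ 2 + x 1 ^ 2 := by
  rw [← real_inner_self_eq_norm_sq, inner_eq_coord]; ring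

@[simp] lemma rot_apply_zero (e : Plane) : rot e 0 = -e 1 := rfl

@[simp] lemma rot_apply_one (e : Plane) : rot e 1 = e 0 := rfl

@[simp] lemma inner_rot_self (e : Plane) : ⟪rot e, e⟫ = 0 := by
  simp [inner_eq_coord]; ring

lemma norm_rot (e : Plane) : ‖rot e‖ = ‖e‖ := by
  have : ‖rot e‖ ^ 2 = ‖e‖ ^ 2 := by simp [norm_sq_eq_coord]; ring
  exact (sq_eq_sq₀ (norm_nonneg _) (norm_nonneg _)).1 this

lemma plane_ext {x y : Plane} (h0 : x 0 = y 0) (h1 : x 1 = y 1) : x = y := by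
  ext i; fin_cases i <;> assumption

lemma coord_sq_of_norm_one {e : Plane} (he : ‖e‖ = 1) : e 0 ^ 2 + e 1 ^ 2 = 1 := by
  rw [← norm_sq_eq_coord, he, one_pow]

lemma planePt_apply_zero (e : Plane) (s y : ℝ) : planePt e s y 0 = -(s * e 1) + y * e 0 := by
  simp [planePt]

lemma planePt_apply_one (e : Plane) (s y : ℝ) : planePt e s y 1 = s * e 0 + y * e 1 := by
  simp [planePt]

lemma planePt_inner {e : Plane} (he : ‖e‖ = 1) (x : Plane) :
    planePt e ⟪x, rot e⟫ ⟪x, e⟫ = x := by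
  have h := coord_sq_of_norm_one he
  apply plane_ext
  · simp only [planePt_apply_zero, inner_eq_coord, rot_apply_zero, rot_apply_one]
    linear_combination x 0 * h
  · simp only [planePt_apply_one, inner_eq_coord, rot_apply_zero, rot_apply_one]
    linear_combination x 1 * h

lemma inner_planePt {e : Plane} (he : ‖e‖ = 1) (s y : ℝ) : ⟪planePt e s y, e⟫ = y := by
  have h := coord_sq_of_norm_one he
  simp only [planePt_apply_zero, planePt_apply_one, inner_eq_coord]
  linear_combination y * h

lemma inner_planePt_rot {e : Plane} (he : ‖e‖ = 1) (s y : ℝ) : ⟪planePt e s y, rot e⟫ = s := by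
  have h := coord_sq_of_norm_one he
  simp only [planePt_apply_zero, planePt_apply_one, inner_eq_coord, rot_apply_zero, rot_apply_one]
  linear_combination s * h

lemma continuous_planePt (e : Plane) : Continuous fun q : ℝ × ℝ => planePt e q.1 q.2 := by
  unfold planePt; fun_prop

/-! ### The positive phase near the free boundary -/

section Local

variable {u : Plane → ℝ}

lemma IsClassicalSolution.isOpen_posPhase (hu : IsClassicalSolution u) : IsOpen (posPhase u) :=
  isOpen_lt continuous_const hu.continuous

lemma isClosed_freeBoundary : IsClosed (freeBoundary u) := isClosed_frontier

lemma freeBoundary_subset_closure : freeBoundary u ⊆ closure (posPhase u) :=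
  frontier_subset_closure

lemma closure_posPhase_eq :
    closure (posPhase u) = posPhase u ∪ freeBoundary u := by
  rw [freeBoundary, closure_eq_self_union_frontier]

lemma IsClassicalSolution.notMem_posPhase (hu : IsClassicalSolution u) {p : Plane}
    (hp : p ∈ freeBoundary u) : p ∉ posPhase u := by
  rw [freeBoundary, hu.isOpen_posPhase.frontier_eq] at hp
  exact hp.2

lemma IsClassicalSolution.eq_zero_of_mem_freeBoundary (hu : IsClassicalSolution u) {p : Plane}
    (hp : p ∈ freeBoundary u) : u p = 0 :=
  le_antisymm (not_lt.1 (hu.notMem_posPhase hp)) (hu.nonneg p)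

/-- A differentiable function that vanishes at `p` is positive on short segments in the directions
in which its derivative is positive. -/
lemma eventually_pos_of_fderiv_pos {g : Plane → ℝ} {p v : Plane} (hg : DifferentiableAt ℝ g p)
    (h0 : g p = 0) (hv : 0 < fderiv ℝ g p v) : ∀ᶠ t in 𝓝[>] (0 : ℝ), 0 < g (p + t • v) := by
  have hline : HasDerivAt (fun t : ℝ => p + t • v) v 0 := by
    simpa using ((hasDerivAt_id (0 : ℝ)).smul_const v).const_add p
  have h1 : HasDerivAt (fun t : ℝ => g (p + t • v)) (fderiv ℝ g p v) 0 := by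
    have hg' : HasFDerivAt g (fderiv ℝ g p) (p + (0 : ℝ) • v) := by
      simpa using hg.hasFDerivAt
    exact hg'.comp_hasDerivAt (0 : ℝ) hline
  have h2 := (hasDerivAt_iff_tendsto_slope.1 h1).eventually (lt_mem_nhds hv)
  have h3 : 𝓝[>] (0 : ℝ) ≤ 𝓝[≠] 0 := nhdsWithin_mono _ fun t ht => ne_of_gt ht
  filter_upwards [h3 h2, self_mem_nhdsWithin] with t ht ht0
  rw [slope_def_field] at ht
  simp only [zero_smul, add_zero, h0, sub_zero] at ht
  exact (div_pos_iff_of_pos_right (mem_Ioi.1 ht0)).1 ht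

/-- A chart of the free boundary: a local defining function. -/
lemma IsClassicalSolution.exists_chart (hu : IsClassicalSolution u) {p : Plane}
    (hp : p ∈ freeBoundary u) : ∃ g : Plane → ℝ, ContDiffAt ℝ ∞ g p ∧ g p = 0 ∧
      fderiv ℝ g p ≠ 0 ∧ (∀ᶠ x in 𝓝 p, x ∈ freeBoundary u ↔ g x = 0) ∧
      (∀ᶠ x in 𝓝 p, 0 < g x → x ∈ posPhase u) ∧ (∀ᶠ x in 𝓝 p, g x < 0 → u x = 0) := by
  obtain ⟨U, hU, hpU, g, hg, hd, h0, h1, h2⟩ := hu.smooth_freeBoundary p hp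
  have hm := hU.mem_nhds hpU
  exact ⟨g, hg.contDiffAt hm, (h0 p hpU).1 hp, hd p hpU, by filter_upwards [hm] using h0,
    by filter_upwards [hm] using h1, by filter_upwards [hm] using h2⟩

lemma tendsto_add_smul (p v : Plane) : Tendsto (fun t : ℝ => p + t • v) (𝓝[>] 0) (𝓝 p) := by
  have : Continuous fun t : ℝ => p + t • v := by fun_prop
  simpa using (this.tendsto 0).mono_left nhdsWithin_le_nhds

lemma eventually_mem_of_chart {g : Plane → ℝ} {p v : Plane} (hg : ContDiffAt ℝ ∞ g p)
    (h0 : g p = 0) (h1 : ∀ᶠ x in 𝓝 p, 0 < g x → x ∈ posPhase u) (hv : 0 < fderiv ℝ g p v) :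
    ∀ᶠ t in 𝓝[>] (0 : ℝ), p + t • v ∈ posPhase u := by
  filter_upwards [eventually_pos_of_fderiv_pos (hg.differentiableAt (by simp)) h0 hv,
    (tendsto_add_smul p v).eventually h1] with t ht ht' using ht' ht

lemma exists_pos_of_ne_zero {l : Plane →L[ℝ] ℝ} (hl : l ≠ 0) : ∃ v, 0 < l v := by
  obtain ⟨v, hv⟩ : ∃ v, l v ≠ 0 := by
    by_contra! h
    exact hl (ContinuousLinearMap.ext h)
  rcases hv.lt_or_gt with h | h
  · exact ⟨-v, by simpa using h⟩
  · exact ⟨v, h⟩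

lemma tendsto_id_nhdsGT_nhdsNE : Tendsto (fun t : ℝ => t) (𝓝[>] 0) (𝓝[≠] 0) :=
  nhdsWithin_mono _ fun _ ht => ne_of_gt ht

lemma mem_tangentConeAt_of_eventually {s : Set Plane} {p v : Plane}
    (h : ∀ᶠ t in 𝓝[>] (0 : ℝ), p + t • v ∈ s) : v ∈ tangentConeAt ℝ s p :=
  mem_tangentConeAt_of_add_smul_mem tendsto_id_nhdsGT_nhdsNE h

/-- At a boundary point the tangent cone contains the open half-plane on which the derivative of the
defining function is positive, and a half-plane spans. This makes the one-sided derivatives well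
defined. -/
lemma IsClassicalSolution.uniqueDiffOn (hu : IsClassicalSolution u) :
    UniqueDiffOn ℝ (closure (posPhase u)) := by
  intro p hp
  rw [closure_posPhase_eq] at hp
  rcases hp with hp | hp
  · exact (hu.isOpen_posPhase.uniqueDiffWithinAt hp).mono subset_closure
  obtain ⟨g, hg, h0, hd, -, h1, -⟩ := hu.exists_chart hp
  refine ⟨?_, subset_closure (freeBoundary_subset_closure hp)⟩
  have hcone : {v | 0 < fderiv ℝ g p v} ⊆ tangentConeAt ℝ (closure (posPhase u)) p := by
    intro v hv
    refine mem_tangentConeAt_of_eventually ?_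
    filter_upwards [eventually_mem_of_chart hg h0 h1 hv] with t ht using subset_closure ht
  have : Submodule.span ℝ (tangentConeAt ℝ (closure (posPhase u)) p) = ⊤ := by
    refine eq_top_iff.2 fun v _ => ?_
    obtain ⟨w, hw⟩ := exists_pos_of_ne_zero hd
    obtain ⟨c, hc⟩ : ∃ c : ℝ, 0 < fderiv ℝ g p (v + c • w) := by
      -- This choice gives `v + c • w` derivative exactly `1`.
      refine ⟨(1 - fderiv ℝ g p v) / fderiv ℝ g p w, ?_⟩
      simp only [map_add, map_smul, smul_eq_mul]
      rw [div_mul_cancel₀ _ hw.ne']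
      linarith
    have e : v = (v + c • w) - c • w := by abel
    rw [e]
    exact Submodule.sub_mem _ (Submodule.subset_span (hcone hc))
      (Submodule.smul_mem _ _ (Submodule.subset_span (hcone hw)))
  rw [this]
  exact dense_univ

lemma IsClassicalSolution.contDiffOn_gradPos (hu : IsClassicalSolution u) :
    ContDiffOn ℝ ∞ (gradPos u) (closure (posPhase u)) := by
  have h := hu.smooth_up_to_boundary.fderivWithin hu.uniqueDiffOn (m := ∞) (by simp)
  exact ((InnerProductSpace.toDual ℝ Plane).symm.toContinuousLinearEquiv.toContinuousLinearMap
    |>.contDiff).comp_contDiffOn h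

lemma inner_gradPos (x v : Plane) :
    ⟪gradPos u x, v⟫ = fderivWithin ℝ u (closure (posPhase u)) x v := by
  simp [gradPos, gradientWithin]

lemma IsClassicalSolution.hasFDerivWithinAt (hu : IsClassicalSolution u) {x : Plane}
    (hx : x ∈ closure (posPhase u)) :
    HasFDerivWithinAt u (innerSL ℝ (gradPos u x)) (closure (posPhase u)) x := by
  have h := ((hu.smooth_up_to_boundary x hx).differentiableWithinAt (by simp)).hasFDerivWithinAt
  have e : innerSL ℝ (gradPos u x) = fderivWithin ℝ u (closure (posPhase u)) x := by
    ext v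
    exact inner_gradPos x v
  rwa [e]

lemma IsClassicalSolution.hasFDerivAt (hu : IsClassicalSolution u) {x : Plane}
    (hx : x ∈ posPhase u) : HasFDerivAt u (innerSL ℝ (gradPos u x)) x :=
  (hu.hasFDerivWithinAt (subset_closure hx)).hasFDerivAt
    (mem_of_superset (hu.isOpen_posPhase.mem_nhds hx) subset_closure)

/-- A one-sided derivative along a ray that enters the set. -/
lemma tendsto_slope_of_hasFDerivWithinAt {E : Type*} [NormedAddCommGroup E] [NormedSpace ℝ E]
    {f : Plane → E} {f' : Plane →L[ℝ] E}
    {s : Set Plane} {p v : Plane} (hf : HasFDerivWithinAt f f' s p)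
    (h : ∀ᶠ t in 𝓝[>] (0 : ℝ), p + t • v ∈ s) :
    Tendsto (fun t : ℝ => t⁻¹ • (f (p + t • v) - f p)) (𝓝[>] 0) (𝓝 (f' v)) := by
  refine hf.lim ?_ h ?_
  · simpa using tendsto_add_smul 0 v
  · refine tendsto_const_nhds.congr' ?_
    filter_upwards [self_mem_nhdsWithin] with t ht
    rw [smul_smul, inv_mul_cancel₀ (ne_of_gt ht), one_smul]

lemma IsClassicalSolution.inner_gradPos_nonneg (hu : IsClassicalSolution u) {p v : Plane}
    (hp : p ∈ freeBoundary u) (h : ∀ᶠ t in 𝓝[>] (0 : ℝ), p + t • v ∈ posPhase u) :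
    0 ≤ ⟪gradPos u p, v⟫ := by
  have h1 := tendsto_slope_of_hasFDerivWithinAt
    (hu.hasFDerivWithinAt (freeBoundary_subset_closure hp))
    (h.mono fun t ht => subset_closure ht)
  refine ge_of_tendsto h1 ?_
  filter_upwards [self_mem_nhdsWithin] with t ht
  rw [hu.eq_zero_of_mem_freeBoundary hp, sub_zero, smul_eq_mul]
  exact mul_nonneg (inv_nonneg.2 (le_of_lt ht)) (hu.nonneg _)

/-- Every direction in the half-plane where `g` increases enters `Ω`, so `∇u` pairs nonnegatively
with it. If `v` were outside that half-plane, subtracting a large multiple of `v` from a direction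
inside would stay inside but make the pairing negative. -/
lemma IsClassicalSolution.fderiv_chart_pos (hu : IsClassicalSolution u) {p v : Plane}
    (hp : p ∈ freeBoundary u) {g : Plane → ℝ} (hg : ContDiffAt ℝ ∞ g p) (h0 : g p = 0)
    (hd : fderiv ℝ g p ≠ 0) (h1 : ∀ᶠ x in 𝓝 p, 0 < g x → x ∈ posPhase u)
    (hv : 0 < ⟪gradPos u p, v⟫) : 0 < fderiv ℝ g p v := by
  have key : ∀ w, 0 < fderiv ℝ g p w → 0 ≤ ⟪gradPos u p, w⟫ := fun w hw =>
    hu.inner_gradPos_nonneg hp (eventually_mem_of_chart hg h0 h1 hw)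
  by_contra! hle
  obtain ⟨w, hw⟩ := exists_pos_of_ne_zero hd
  obtain ⟨c, hc, hc'⟩ : ∃ c : ℝ, 0 < c ∧ ⟪gradPos u p, w⟫ < c * ⟪gradPos u p, v⟫ := by
    refine ⟨|⟪gradPos u p, w⟫| / ⟪gradPos u p, v⟫ + 1, by positivity, ?_⟩
    rw [add_mul, div_mul_cancel₀ _ hv.ne']
    linarith [le_abs_self ⟪gradPos u p, w⟫]
  have h2 := key (w - c • v) (by
    simp only [map_sub, map_smul, smul_eq_mul]
    nlinarith)
  rw [inner_sub_right, inner_smul_right] at h2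
  linarith

lemma IsClassicalSolution.eventually_mem_posPhase (hu : IsClassicalSolution u) {p v : Plane}
    (hp : p ∈ freeBoundary u) (hv : 0 < ⟪gradPos u p, v⟫) :
    ∀ᶠ t in 𝓝[>] (0 : ℝ), p + t • v ∈ posPhase u := by
  obtain ⟨g, hg, h0, hd, -, h1, -⟩ := hu.exists_chart hp
  exact eventually_mem_of_chart hg h0 h1 (hu.fderiv_chart_pos hp hg h0 hd h1 hv)

/-- Near each of its points the free boundary is a `C¹` graph in any direction that enters the
positive phase. -/
lemma IsClassicalSolution.exists_local_graph (hu : IsClassicalSolution u) {p e : Plane}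
    (hp : p ∈ freeBoundary u) (he : ‖e‖ = 1) (hpe : 0 < ⟪gradPos u p, e⟫) :
    ∃ h : ℝ → ℝ, ContDiffAt ℝ 1 h ⟪p, rot e⟫ ∧ h ⟪p, rot e⟫ = ⟪p, e⟫ ∧
      ∀ᶠ x in 𝓝 p, x ∈ freeBoundary u ↔ h ⟪x, rot e⟫ = ⟪x, e⟫ := by
  obtain ⟨g, hg, h0, hd, hF, h1, -⟩ := hu.exists_chart hp
  have hge := hu.fderiv_chart_pos hp hg h0 hd h1 hpe
  let q : ℝ × ℝ := (⟪p, rot e⟫, ⟪p, e⟫)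
  let P : ℝ × ℝ →L[ℝ] Plane :=
    (ContinuousLinearMap.fst ℝ ℝ ℝ).smulRight (rot e) + (ContinuousLinearMap.snd ℝ ℝ ℝ).smulRight e
  have hP : ∀ z, P z = planePt e z.1 z.2 := fun z => by simp [P, planePt]
  have hPq : P q = p := by rw [hP]; exact planePt_inner he p
  have hf : ContDiffAt ℝ 1 (fun z => g (P z)) q := by
    have : ContDiffAt ℝ 1 g (P q) := by rw [hPq]; exact hg.of_le (by simp)
    exact this.comp q P.contDiff.contDiffAt
  have hfd : fderiv ℝ (fun z => g (P z)) q = (fderiv ℝ g p).comp P := by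
    have : HasFDerivAt g (fderiv ℝ g p) (P q) := by
      rw [hPq]; exact (hg.differentiableAt (by simp)).hasFDerivAt
    exact (this.comp q P.hasFDerivAt).fderiv
  -- The partial derivative along `e` is the positive number `hge`, so the implicit function theorem
  -- solves for the height over the line spanned by `rot e`.
  have hinv : (fderiv ℝ (fun z => g (P z)) q ∘L .inr ℝ ℝ ℝ).IsInvertible := by
    refine ⟨ContinuousLinearEquiv.unitsEquivAut ℝ (Units.mk0 _ hge.ne'), ?_⟩
    ext
    rw [hfd]
    simp [hP, planePt]
  refine ⟨hf.implicitFunction one_ne_zero hinv, hf.contDiffAt_implicitFunction one_ne_zero hinv,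
    hf.implicitFunction_apply_self one_ne_zero hinv, ?_⟩
  have hcoord : Tendsto (fun x : Plane => ((⟪x, rot e⟫, ⟪x, e⟫) : ℝ × ℝ)) (𝓝 p) (𝓝 q) := by
    have : Continuous fun x : Plane => ((⟪x, rot e⟫, ⟪x, e⟫) : ℝ × ℝ) := by fun_prop
    exact this.tendsto p
  filter_upwards [hF, hcoord.eventually
    (hf.eventually_apply_eq_iff_implicitFunction one_ne_zero hinv)] with x hx hx'
  rw [hx, ← hx']
  simp only [hP, planePt_inner he]
  rw [show planePt e q.1 q.2 = p from planePt_inner he p, h0]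

end Local

/-! ### Positive harmonic functions in the plane -/

section Harmonic

open InnerProductSpace Metric

/-- The standard identification of the complex numbers with the plane. -/
def cplx : ℂ ≃ₗᵢ[ℝ] Plane := Complex.orthonormalBasisOneI.repr

lemma cplx_one : cplx 1 = EuclideanSpace.single 0 1 := by
  apply plane_ext <;> simp [cplx, Complex.orthonormalBasisOneI]

lemma cplx_I : cplx Complex.I = EuclideanSpace.single 1 1 := by
  apply plane_ext <;> simp [cplx, Complex.orthonormalBasisOneI]

lemma laplacian_eq_sum (u : Plane → ℝ) (x : Plane) :
    Laplacian.laplacian u x =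
      ∑ i : Fin 2, iteratedFDeriv ℝ 2 u x
        ![EuclideanSpace.single i 1, EuclideanSpace.single i 1] := by
  rw [laplacian_eq_iteratedFDeriv_orthonormalBasis u (EuclideanSpace.basisFun (Fin 2) ℝ)]
  simp

lemma harmonicAt_comp_cplx {u : Plane → ℝ} {z : ℂ} (h : HarmonicAt u (cplx z)) :
    HarmonicAt (fun w => u (cplx w)) z := by
  have hc : ∀ w, HarmonicAt u (cplx w) →
      Laplacian.laplacian (fun w => u (cplx w)) w = Laplacian.laplacian u (cplx w) := by
    intro w hw
    have hcomp : ∀ m : Fin 2 → ℂ, iteratedFDeriv ℝ 2 (fun w => u (cplx w)) w m =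
        iteratedFDeriv ℝ 2 u (cplx w) fun i => cplx (m i) := by
      intro m
      have h1 := ContinuousLinearEquiv.iteratedFDerivWithin_comp_right (𝕜 := ℝ)
        cplx.toContinuousLinearEquiv u (s := univ) uniqueDiffOn_univ (x := w) (mem_univ _) 2
      simp only [preimage_univ, iteratedFDerivWithin_univ] at h1
      have h2 := congrArg (fun T => T m) h1
      exact h2
    rw [laplacian_eq_iteratedFDeriv_complexPlane, laplacian_eq_sum]
    simp only [hcomp, Fin.sum_univ_two]
    congr 2
    · ext i j; fin_cases i <;> simp [cplx_one]
    · ext i j; fin_cases i <;> simp [cplx_I]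
  refine ⟨h.1.comp z cplx.toContinuousLinearEquiv.contDiff.contDiffAt, ?_⟩
  have h' : ∀ᶠ w in 𝓝 z, HarmonicAt u (cplx w) :=
    (cplx.continuous.tendsto z).eventually h.eventually
  filter_upwards [h', (cplx.continuous.tendsto z).eventually h.2] with w hw hw'
  rw [hc w hw]
  exact hw'

/-- A form of the Harnack inequality for positive harmonic functions on a disk of `ℂ`. -/
lemma abs_sub_le_of_harmonic_complex {v : ℂ → ℝ} {c : ℂ} {R : ℝ}
    (hv : HarmonicOnNhd v (ball c R)) (hpos : ∀ z ∈ ball c R, 0 < v z) {z : ℂ}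
    (hz : z ∈ ball c R) : |v z - v c| ≤ dist z c / R * (v z + v c) := by
  obtain ⟨G, hG, hGv⟩ := hv.exists_analyticOnNhd_ball_re_eq
  have hR : 0 < R := pos_of_mem_ball hz
  have hc : c ∈ ball c R := mem_ball_self hR
  have hre : ∀ w ∈ ball c R, (G w).re = v w := hGv
  have hGre : ∀ w ∈ ball c R, 0 < (G w).re := fun w hw => by rw [hre w hw]; exact hpos w hw
  -- The Cayley transform sends the right half-plane to the unit disk and `G c` to `0`, so the
  -- Schwarz lemma applies to `W`.
  let W : ℂ → ℂ := fun w => (G w - G c) / (G w + (starRingEnd ℂ) (G c))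
  have hden : ∀ w ∈ ball c R, G w + (starRingEnd ℂ) (G c) ≠ 0 := by
    intro w hw h
    have := congrArg Complex.re h
    simp at this
    linarith [hGre w hw, hGre c hc]
  have hle : ∀ w ∈ ball c R, ‖G w - G c‖ ≤ ‖G w + (starRingEnd ℂ) (G c)‖ := by
    intro w hw
    rw [← sq_le_sq₀ (norm_nonneg _) (norm_nonneg _), Complex.sq_norm, Complex.sq_norm,
      Complex.normSq_apply, Complex.normSq_apply]
    simp
    nlinarith [mul_pos (hGre w hw) (hGre c hc)]
  have hWd : DifferentiableOn ℂ W (ball c R) :=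
    (hG.differentiableOn.sub_const _).div (hG.differentiableOn.add_const _) hden
  have hWc : W c = 0 := by simp [W]
  have hWm : MapsTo W (ball c R) (closedBall (W c) 1) := by
    intro w hw
    rw [hWc, mem_closedBall_zero_iff, norm_div]
    exact div_le_one_of_le₀ (hle w hw) (norm_nonneg _)
  have hS := Complex.dist_le_div_mul_dist_of_mapsTo_ball hWd hWm hz
  rw [hWc, dist_zero_right, norm_div, div_le_iff₀ (norm_pos_iff.2 (hden z hz))] at hS
  set ρ : ℝ := dist z c / R with hρ
  have hρ' : 1 / R * dist z c = ρ := by rw [hρ]; ring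
  rw [hρ'] at hS
  have hρ0 : 0 ≤ ρ := by positivity
  have hρ1 : ρ ≤ 1 := by
    rw [hρ, div_le_one hR]; exact (mem_ball.1 hz).le
  have hsq := mul_self_le_mul_self (norm_nonneg _) hS
  have e1 : ‖G z - G c‖ * ‖G z - G c‖ = (v z - v c) ^ 2 + ((G z).im - (G c).im) ^ 2 := by
    rw [← sq, Complex.sq_norm, Complex.normSq_apply]
    simp [hre z hz, hre c hc]; ring
  have e2 : ‖G z + (starRingEnd ℂ) (G c)‖ * ‖G z + (starRingEnd ℂ) (G c)‖ =
      (v z + v c) ^ 2 + ((G z).im - (G c).im) ^ 2 := by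
    rw [← sq, Complex.sq_norm, Complex.normSq_apply]
    simp [hre z hz, hre c hc]; ring
  have hv0 : 0 < v z + v c := add_pos (hpos z hz) (hpos c hc)
  -- The same squared difference of imaginary parts occurs on both sides of `hsq`; it can be dropped
  -- because `ρ ≤ 1`.
  refine abs_le_of_sq_le_sq ?_ (by positivity)
  have hρ2 : ρ ^ 2 ≤ 1 := pow_le_one₀ hρ0 hρ1
  nlinarith [sq_nonneg ((G z).im - (G c).im)]

lemma abs_sub_le_of_harmonic {u : Plane → ℝ} {x : Plane} {R : ℝ}
    (hu : HarmonicOnNhd u (ball x R)) (hpos : ∀ y ∈ ball x R, 0 < u y) {y : Plane}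
    (hy : y ∈ ball x R) : |u y - u x| ≤ dist y x / R * (u y + u x) := by
  have hmem : ∀ w, w ∈ ball (cplx.symm x) R → cplx w ∈ ball x R := by
    intro w hw
    rw [mem_ball, ← cplx.apply_symm_apply x, cplx.dist_map]
    exact hw
  have hy' : cplx.symm y ∈ ball (cplx.symm x) R := by
    rw [mem_ball, cplx.symm.dist_map]; exact hy
  have := abs_sub_le_of_harmonic_complex (v := fun w => u (cplx w))
    (fun w hw => harmonicAt_comp_cplx (hu _ (hmem w hw))) (fun w hw => hpos _ (hmem w hw)) hy'
  simpa [cplx.symm.dist_map] using this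

/-- Infinitesimal form of the Harnack estimate: as `y` tends to `x`, the factor `u y + u x` tends to
`2 * u x`. -/
lemma norm_fderiv_le_of_harmonic {u : Plane → ℝ} {x : Plane} {R : ℝ} (hR : 0 < R)
    (hu : HarmonicOnNhd u (ball x R)) (hpos : ∀ y ∈ ball x R, 0 < u y) :
    ‖fderiv ℝ u x‖ ≤ 2 * u x / R := by
  have hx : x ∈ ball x R := mem_ball_self hR
  refine le_of_forall_pos_le_add fun ε hε => ?_
  have hcont : ContinuousAt u x := (hu x hx).1.continuousAt
  have hx0 := hpos x hx
  refine norm_fderiv_le_of_lip' ℝ (by positivity) ?_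
  have h1 : ∀ᶠ y in 𝓝 x, u y < u x + ε * R :=
    hcont.eventually (gt_mem_nhds (by nlinarith [mul_pos hε hR]))
  filter_upwards [h1, ball_mem_nhds x hR] with y hy hyb
  rw [Real.norm_eq_abs, ← dist_eq_norm]
  refine (abs_sub_le_of_harmonic hu hpos hyb).trans ?_
  have : dist y x / R * (u y + u x) ≤ dist y x / R * (2 * u x + ε * R) :=
    mul_le_mul_of_nonneg_left (by linarith) (by positivity)
  refine this.trans (le_of_eq ?_)
  field_simp

end Harmonic

/-! ### The gradient bound -/

section Gradient

open InnerProductSpace Metric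

variable {u : Plane → ℝ}

/-- The ball is connected, so it cannot leave `Ω` without meeting the free boundary. -/
lemma IsClassicalSolution.ball_subset_posPhase (hu : IsClassicalSolution u) {x : Plane} {d : ℝ}
    (hx : x ∈ posPhase u) (hd : ∀ p ∈ freeBoundary u, d ≤ dist x p) :
    ball x d ⊆ posPhase u := by
  rcases le_or_gt d 0 with h0 | h0
  · simp [ball_eq_empty.2 h0]
  refine (convex_ball x d).isPreconnected.subset_left_of_subset_union hu.isOpen_posPhase
    isClosed_closure.isOpen_compl
    (disjoint_compl_right.mono_left subset_closure) ?_ ⟨x, mem_ball_self h0, hx⟩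
  intro y hy
  by_contra hcon
  simp only [mem_union, mem_compl_iff, not_or, not_not] at hcon
  have hyF : y ∈ freeBoundary u := by
    rw [freeBoundary, hu.isOpen_posPhase.frontier_eq]; exact ⟨hcon.2, hcon.1⟩
  have := hd y hyF
  rw [mem_ball, dist_comm] at hy
  linarith

lemma IsClassicalSolution.gradPos_eq_gradient (hu : IsClassicalSolution u) {x : Plane}
    (hx : x ∈ posPhase u) : gradPos u x = gradient u x := by
  rw [gradPos, gradientWithin, gradient,
    fderivWithin_of_mem_nhds (mem_of_superset (hu.isOpen_posPhase.mem_nhds hx) subset_closure)]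

/-- A crude bound that feeds the Phragmén–Lindelöf argument. On the segment from the nearest
boundary point `p`, Harnack forces `u` to grow at least at rate `u x / 2`, as in the Hopf lemma.
Since `|∇u p| = 1`, this gives `u x ≤ 2 * d`, and the interior gradient estimate on the ball of
radius `d` gives `4`. -/
lemma IsClassicalSolution.norm_gradPos_le_four (hu : IsClassicalSolution u)
    (hF : (freeBoundary u).Nonempty) {x : Plane} (hx : x ∈ posPhase u) :
    ‖gradPos u x‖ ≤ 4 := by
  obtain ⟨p, hp, hxp⟩ := isClosed_freeBoundary.exists_infDist_eq_dist hF x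
  set d := dist x p with hd
  have hd0 : 0 < d := dist_pos.2 fun h => hu.notMem_posPhase hp (h ▸ hx)
  have hball : ball x d ⊆ posPhase u := hu.ball_subset_posPhase hx fun q hq => by
    rw [← hxp]; exact infDist_le_dist_of_mem hq
  have hharm : HarmonicOnNhd u (ball x d) := hu.harmonic.mono hball
  have hpos : ∀ y ∈ ball x d, 0 < u y := hball
  have hx0 : 0 < u x := hx
  have hdist : ∀ t ∈ Ioo (0 : ℝ) 1, dist (p + t • (x - p)) x = (1 - t) * d := by
    intro t ht
    have : p + t • (x - p) - x = -((1 - t) • (x - p)) := by module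
    rw [dist_eq_norm, this, norm_neg, norm_smul, Real.norm_of_nonneg (by linarith [ht.2]), hd,
      dist_eq_norm]
  have hmem : ∀ t ∈ Ioo (0 : ℝ) 1, p + t • (x - p) ∈ ball x d := by
    intro t ht
    rw [mem_ball, hdist t ht]
    nlinarith [ht.1]
  have hev : ∀ᶠ t in 𝓝[>] (0 : ℝ), t ∈ Ioo (0 : ℝ) 1 := Ioo_mem_nhdsGT one_pos
  have hlim := tendsto_slope_of_hasFDerivWithinAt (v := x - p)
    (hu.hasFDerivWithinAt (freeBoundary_subset_closure hp))
    (hev.mono fun t ht => subset_closure (hball (hmem t ht)))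
  -- At parameter `t` the Harnack ratio is `1 - t`, which yields `t * u x ≤ (2 - t) * u (p + t • (x
  -- - p))`.
  have hux : u x / 2 ≤ ⟪gradPos u p, x - p⟫ := by
    refine ge_of_tendsto hlim ?_
    filter_upwards [hev] with t ht
    rw [hu.eq_zero_of_mem_freeBoundary hp, sub_zero, smul_eq_mul, inv_mul_eq_div,
      le_div_iff₀ ht.1]
    have h1 := abs_sub_le_of_harmonic hharm hpos (hmem t ht)
    rw [hdist t ht, mul_div_assoc, div_self hd0.ne', mul_one] at h1
    have h2 := neg_abs_le (u (p + t • (x - p)) - u x)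
    have h3 := hpos _ (hmem t ht)
    nlinarith [ht.1, mul_pos ht.1 h3]
  have hup : u x ≤ 2 * d := by
    have := real_inner_le_norm (gradPos u p) (x - p)
    rw [hu.norm_grad_eq_one p hp, one_mul, ← dist_eq_norm] at this
    linarith
  have hg := norm_fderiv_le_of_harmonic hd0 hharm hpos
  rw [hu.gradPos_eq_gradient hx, gradient, LinearIsometryEquiv.norm_map]
  refine hg.trans ?_
  rw [div_le_iff₀ hd0]
  linarith

/-- If the closure were the whole plane, `u` would be differentiable with a minimum at a free
boundary point, and its gradient there would vanish instead of having norm one. The point `q` serves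
as the pole of the auxiliary function in the gradient bound. -/
lemma IsClassicalSolution.exists_notMem_closure (hu : IsClassicalSolution u)
    (hF : (freeBoundary u).Nonempty) : ∃ q, q ∉ closure (posPhase u) := by
  by_contra! h
  obtain ⟨p, hp⟩ := hF
  have hd := hu.hasFDerivWithinAt (freeBoundary_subset_closure hp)
  rw [eq_univ_of_forall h, hasFDerivWithinAt_univ] at hd
  have hmin : IsLocalMin u p := by
    refine Eventually.of_forall fun y => ?_
    rw [hu.eq_zero_of_mem_freeBoundary hp]
    exact hu.nonneg y
  have h0 := hmin.hasFDerivAt_eq_zero hd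
  have h1 : ⟪gradPos u p, gradPos u p⟫ = 0 := by
    have := congrArg (fun l => l (gradPos u p)) h0
    simpa using this
  rw [real_inner_self_eq_norm_sq, hu.norm_grad_eq_one p hp] at h1
  norm_num at h1

/-- The holomorphic function `∂u/∂x - i ∂u/∂y`, extended to the closure of the positive phase. -/
def complexGrad (u : Plane → ℝ) (z : ℂ) : ℂ :=
  (gradPos u (cplx z) 0 : ℂ) - Complex.I * (gradPos u (cplx z) 1 : ℂ)

lemma norm_complexGrad (z : ℂ) : ‖complexGrad u z‖ = ‖gradPos u (cplx z)‖ := by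
  have : ‖complexGrad u z‖ ^ 2 = ‖gradPos u (cplx z)‖ ^ 2 := by
    rw [Complex.sq_norm, Complex.normSq_apply, norm_sq_eq_coord, complexGrad]
    simp
    ring
  exact (sq_eq_sq₀ (norm_nonneg _) (norm_nonneg _)).1 this

lemma IsClassicalSolution.continuousOn_complexGrad (hu : IsClassicalSolution u) :
    ContinuousOn (complexGrad u) (cplx ⁻¹' closure (posPhase u)) := by
  have h : ContinuousOn (fun z => gradPos u (cplx z)) (cplx ⁻¹' closure (posPhase u)) :=
    hu.contDiffOn_gradPos.continuousOn.comp cplx.continuous.continuousOn fun z hz => hz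
  have h0 : ∀ i, ContinuousOn (fun z => gradPos u (cplx z) i)
      (cplx ⁻¹' closure (posPhase u)) := fun i => by fun_prop
  unfold complexGrad
  exact (Complex.continuous_ofReal.comp_continuousOn (h0 0)).sub
    (continuousOn_const.mul (Complex.continuous_ofReal.comp_continuousOn (h0 1)))

lemma IsClassicalSolution.gradPos_apply (hu : IsClassicalSolution u) {x : Plane}
    (hx : x ∈ posPhase u) (i : Fin 2) :
    gradPos u x i = fderiv ℝ u x (EuclideanSpace.single i 1) := by
  rw [(hu.hasFDerivAt hx).fderiv]
  simp [EuclideanSpace.inner_single_right]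

lemma IsClassicalSolution.differentiableOn_complexGrad (hu : IsClassicalSolution u) :
    DifferentiableOn ℂ (complexGrad u) (cplx ⁻¹' posPhase u) := by
  intro z hz
  have h := HarmonicAt.differentiableAt_complex_partial (harmonicAt_comp_cplx (hu.harmonic _ hz))
  refine (h.congr_of_eventuallyEq ?_).differentiableWithinAt
  have : ∀ᶠ w in 𝓝 z, cplx w ∈ posPhase u :=
    (cplx.continuous.tendsto z).eventually (hu.isOpen_posPhase.mem_nhds hz)
  filter_upwards [this] with w hw
  have hd : fderiv ℝ (fun w => u (cplx w)) w =
      (fderiv ℝ u (cplx w)).comp (cplx : ℂ →L[ℝ] Plane) := by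
    have h1 : HasFDerivAt u (fderiv ℝ u (cplx w)) (cplx w) :=
      (hu.hasFDerivAt hw).differentiableAt.hasFDerivAt
    exact (h1.comp w (cplx : ℂ →L[ℝ] Plane).hasFDerivAt).fderiv
  rw [complexGrad, hu.gradPos_apply hw, hu.gradPos_apply hw, hd]
  simp [cplx_one, cplx_I]

/-- The gradient of a global classical solution has norm at most one. -/
theorem IsClassicalSolution.norm_gradPos_le_one (hu : IsClassicalSolution u)
    (hF : (freeBoundary u).Nonempty) {x : Plane} (hx : x ∈ closure (posPhase u)) :
    ‖gradPos u x‖ ≤ 1 := by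
  rw [closure_posPhase_eq] at hx
  rcases hx with hx | hx
  swap
  · exact (hu.norm_grad_eq_one x hx).le
  obtain ⟨q, hq⟩ := hu.exists_notMem_closure hF
  obtain ⟨r, hr, hball⟩ := Metric.isOpen_iff.1 isClosed_closure.isOpen_compl q hq
  have hdist : ∀ y ∈ closure (posPhase u), r ≤ dist y q := by
    intro y hy
    by_contra! h
    exact hball (mem_ball.2 h) hy
  set c := cplx.symm q with hc
  have hdc : ∀ z : ℂ, ‖z - c‖ = dist (cplx z) q := by
    intro z
    rw [← dist_eq_norm, ← cplx.dist_map, hc, cplx.apply_symm_apply]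
  -- Maximum principle for `f ^ n * (r / (z - c))`, where `f` is the complex gradient, on the part
  -- of `Ω` in a large disk. On `F(u)` both factors have modulus at most one; on the circle the
  -- decay of the second beats `4 ^ n`. The right side does not depend on `n`, which forces
  -- `‖gradPos u x‖ ≤ 1`.
  have hpow : ∀ n : ℕ, ‖gradPos u x‖ ^ n ≤ dist x q / r := by
    intro n
    -- The first entry absorbs the crude bound on the circle, the second keeps `x` inside the disk.
    set R : ℝ := max (4 ^ n * r) (dist x q + 1) with hR
    have hR0 : 0 < R := lt_of_lt_of_le (by positivity) (le_max_right _ _)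
    set V : Set ℂ := cplx ⁻¹' posPhase u ∩ ball c R with hV
    have hcl : closure V ⊆ cplx ⁻¹' closure (posPhase u) :=
      (closure_mono inter_subset_left).trans
        (closure_minimal (preimage_mono subset_closure)
          (isClosed_closure.preimage cplx.continuous))
    have hopen : IsOpen V := (hu.isOpen_posPhase.preimage cplx.continuous).inter isOpen_ball
    have hne : ∀ z ∈ cplx ⁻¹' closure (posPhase u), z - c ≠ 0 := by
      intro z hz h0
      have := hdist _ hz
      rw [← hdc, h0, norm_zero] at this
      linarith
    have hdiff : DiffContOnCl ℂ (fun z => complexGrad u z ^ n * (r / (z - c))) V := by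
      constructor
      · refine ((hu.differentiableOn_complexGrad.mono inter_subset_left).pow n).mul ?_
        exact (differentiableOn_const _).div (differentiableOn_id.sub_const c)
          fun z hz => hne z (hcl (subset_closure hz))
      · refine ((hu.continuousOn_complexGrad.mono hcl).pow n).mul ?_
        exact continuousOn_const.div (continuousOn_id.sub continuousOn_const)
          fun z hz => hne z (hcl hz)
    have hnorm : ∀ z, ‖complexGrad u z ^ n * (r / (z - c))‖ =
        ‖gradPos u (cplx z)‖ ^ n * (r / dist (cplx z) q) := by
      intro z
      rw [norm_mul, norm_pow, norm_complexGrad, norm_div, hdc, Complex.norm_real,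
        Real.norm_of_nonneg hr.le]
    have hfr : ∀ z ∈ frontier V, ‖complexGrad u z ^ n * (r / (z - c))‖ ≤ 1 := by
      intro z hz
      have hzD := hcl (frontier_subset_closure hz)
      have hrd := hdist _ hzD
      rw [hnorm]
      by_cases hzΩ : cplx z ∈ posPhase u
      · have hzR : R ≤ dist (cplx z) q := by
          by_contra! h
          rw [hopen.frontier_eq] at hz
          refine hz.2 ⟨hzΩ, ?_⟩
          rwa [mem_ball, dist_eq_norm, hdc]
        have h4 := pow_le_pow_left₀ (norm_nonneg _) (hu.norm_gradPos_le_four hF hzΩ) n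
        have hd0 : 0 < dist (cplx z) q := hR0.trans_le hzR
        rw [← mul_div_assoc, div_le_one hd0]
        calc ‖gradPos u (cplx z)‖ ^ n * r ≤ 4 ^ n * r := by gcongr
          _ ≤ R := le_max_left _ _
          _ ≤ _ := hzR
      · have hzF : cplx z ∈ freeBoundary u := by
          rw [freeBoundary, hu.isOpen_posPhase.frontier_eq]; exact ⟨hzD, hzΩ⟩
        rw [hu.norm_grad_eq_one _ hzF, one_pow, one_mul]
        exact div_le_one_of_le₀ hrd dist_nonneg
    have hbdd : Bornology.IsBounded V := isBounded_ball.subset inter_subset_right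
    have hxV : cplx.symm x ∈ V := by
      refine ⟨by simpa using hx, ?_⟩
      rw [mem_ball, dist_eq_norm, hdc, cplx.apply_symm_apply]
      exact lt_of_lt_of_le (by linarith) (le_max_right _ _)
    have := Complex.norm_le_of_forall_mem_frontier_norm_le hbdd hdiff hfr (subset_closure hxV)
    rw [hnorm, cplx.apply_symm_apply] at this
    have hd0 : 0 < dist x q := hr.trans_le (hdist x (subset_closure hx))
    rw [← mul_div_assoc, div_le_one hd0] at this
    rwa [le_div_iff₀ hr]
  by_contra! h1
  obtain ⟨n, hn⟩ := pow_unbounded_of_one_lt (dist x q / r) h1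
  exact absurd (hpow n) (not_le.2 hn)

end Gradient

/-! ### Curvature of the free boundary -/

section Curvature

variable {u : Plane → ℝ}

/-- Normalization is constant along rays, so at a unit vector its derivative is the projection onto
the orthogonal complement. -/
lemma hasFDerivAt_inv_norm_smul {w : Plane} (hw : ‖w‖ = 1) :
    HasFDerivAt (fun y : Plane => ‖y‖⁻¹ • y)
      (ContinuousLinearMap.id ℝ Plane - (innerSL ℝ w).smulRight w) w := by
  have h1 : HasFDerivAt (fun y : Plane => √(‖y‖ ^ 2)) (innerSL ℝ w) w := by
    have := (hasStrictFDerivAt_norm_sq w).hasFDerivAt.sqrt (by simp [hw])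
    convert! this using 1
    ext v
    simp [hw]
  have h2 : HasFDerivAt (fun y : Plane => ‖y‖) (innerSL ℝ w) w := by
    simpa only [Real.sqrt_sq (norm_nonneg _)] using h1
  have h3 : HasFDerivAt (fun y : Plane => ‖y‖⁻¹) (-(innerSL ℝ w)) w := by
    have := (hasDerivAt_inv (by simp [hw] : ‖w‖ ≠ 0)).comp_hasFDerivAt w h2
    have e : (-(‖w‖ ^ 2)⁻¹) • innerSL ℝ w = -(innerSL ℝ w) := by simp [hw]
    rw [e] at this
    exact this
  have h4 := h3.smul (hasFDerivAt_id w)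
  convert! h4 using 1
  ext v : 1
  simp [hw, sub_eq_add_neg]

lemma contDiffAt_inv_norm_smul {w : Plane} (hw : w ≠ 0) :
    ContDiffAt ℝ ∞ (fun y : Plane => ‖y‖⁻¹ • y) w :=
  ((contDiffAt_norm ℝ hw).inv (norm_ne_zero_iff.2 hw)).smul contDiffAt_id

lemma IsClassicalSolution.innerNormal_eq (hu : IsClassicalSolution u) {p : Plane}
    (hp : p ∈ freeBoundary u) : innerNormal u p = gradPos u p := by
  rw [innerNormal, hu.norm_grad_eq_one p hp, inv_one, one_smul]

lemma IsClassicalSolution.contDiffWithinAt_innerNormal (hu : IsClassicalSolution u) {p : Plane}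
    (hp : p ∈ freeBoundary u) :
    ContDiffWithinAt ℝ ∞ (innerNormal u) (closure (posPhase u)) p := by
  have h0 : gradPos u p ≠ 0 := fun h => by
    have := hu.norm_grad_eq_one p hp
    rw [h, norm_zero] at this
    norm_num at this
  exact (contDiffAt_inv_norm_smul h0).comp_contDiffWithinAt p
    (hu.contDiffOn_gradPos p (freeBoundary_subset_closure hp))

lemma IsClassicalSolution.hasFDerivWithinAt_gradPos (hu : IsClassicalSolution u) {x : Plane}
    (hx : x ∈ closure (posPhase u)) :
    HasFDerivWithinAt (gradPos u) (fderivWithin ℝ (gradPos u) (closure (posPhase u)) x)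
      (closure (posPhase u)) x :=
  ((hu.contDiffOn_gradPos x hx).differentiableWithinAt (by simp)).hasFDerivWithinAt

lemma IsClassicalSolution.hasFDerivWithinAt_innerNormal (hu : IsClassicalSolution u) {p : Plane}
    (hp : p ∈ freeBoundary u) :
    HasFDerivWithinAt (innerNormal u) (fderivWithin ℝ (innerNormal u) (closure (posPhase u)) p)
      (closure (posPhase u)) p :=
  ((hu.contDiffWithinAt_innerNormal hp).differentiableWithinAt (by simp)).hasFDerivWithinAt

/-- The derivative of the inner normal is the tangential part of the Hessian. -/
lemma IsClassicalSolution.fderivWithin_innerNormal (hu : IsClassicalSolution u) {p : Plane}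
    (hp : p ∈ freeBoundary u) (v : Plane) :
    fderivWithin ℝ (innerNormal u) (closure (posPhase u)) p v =
      fderivWithin ℝ (gradPos u) (closure (posPhase u)) p v -
        ⟪gradPos u p, fderivWithin ℝ (gradPos u) (closure (posPhase u)) p v⟫ • gradPos u p := by
  have hpD := freeBoundary_subset_closure hp
  have h := (hasFDerivAt_inv_norm_smul (hu.norm_grad_eq_one p hp)).comp_hasFDerivWithinAt p
    (hu.hasFDerivWithinAt_gradPos hpD)
  have h' := h.fderivWithin (hu.uniqueDiffOn p hpD)
  rw [show innerNormal u = (fun y : Plane => ‖y‖⁻¹ • y) ∘ gradPos u from rfl, h']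
  simp

/-- The Hessian is trace free up to the boundary. -/
lemma IsClassicalSolution.trace_hessian_eq_zero (hu : IsClassicalSolution u) {x : Plane}
    (hx : x ∈ closure (posPhase u)) :
    ∑ i : Fin 2, (fderivWithin ℝ (gradPos u) (closure (posPhase u)) x
      (EuclideanSpace.single i 1)) i = 0 := by
  have hc : ContinuousWithinAt (fun x => ∑ i : Fin 2,
      (fderivWithin ℝ (gradPos u) (closure (posPhase u)) x (EuclideanSpace.single i 1)) i)
      (closure (posPhase u)) x := by
    have h1 : ContinuousWithinAt (fderivWithin ℝ (gradPos u) (closure (posPhase u)))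
        (closure (posPhase u)) x :=
      (hu.contDiffOn_gradPos.continuousOn_fderivWithin hu.uniqueDiffOn (by simp)) x hx
    have h2 : ∀ i : Fin 2, ContinuousWithinAt (fun x =>
        (fderivWithin ℝ (gradPos u) (closure (posPhase u)) x (EuclideanSpace.single i 1)) i)
        (closure (posPhase u)) x := fun i => by fun_prop
    simp only [Fin.sum_univ_two]
    exact (h2 0).add (h2 1)
  -- By continuity it is enough to treat points of `Ω`, where the trace is the Laplacian.
  refine (hc.mono subset_closure).eq_const_of_mem_closure hx fun y hy => ?_
  have hnhds : closure (posPhase u) ∈ 𝓝 y :=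
    mem_of_superset (hu.isOpen_posPhase.mem_nhds hy) subset_closure
  rw [fderivWithin_of_mem_nhds hnhds]
  have hlap : Laplacian.laplacian u y = 0 := (hu.harmonic y hy).2.eq_of_nhds
  rw [laplacian_eq_sum] at hlap
  rw [← hlap]
  refine Finset.sum_congr rfl fun i _ => ?_
  have hG : DifferentiableAt ℝ (gradPos u) y :=
    (hu.hasFDerivWithinAt_gradPos (subset_closure hy)).differentiableWithinAt.differentiableAt
      hnhds
  have h1 : HasFDerivAt (fun z => gradPos u z i)
      ((EuclideanSpace.proj i : Plane →L[ℝ] ℝ).comp (fderiv ℝ (gradPos u) y)) y :=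
    (EuclideanSpace.proj i : Plane →L[ℝ] ℝ).hasFDerivAt.comp y hG.hasFDerivAt
  have hu2 : DifferentiableAt ℝ (fderiv ℝ u) y :=
    ((hu.harmonic y hy).1.fderiv_right (m := 1) (by norm_num)).differentiableAt (by simp)
  have h2 : HasFDerivAt (fun z => gradPos u z i)
      ((ContinuousLinearMap.apply ℝ ℝ (EuclideanSpace.single i (1 : ℝ) : Plane)).comp
        (fderiv ℝ (fderiv ℝ u) y)) y := by
    refine ((ContinuousLinearMap.apply ℝ ℝ (EuclideanSpace.single i (1 : ℝ) : Plane)).hasFDerivAt.comp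
      y hu2.hasFDerivAt).congr_of_eventuallyEq ?_
    filter_upwards [hu.isOpen_posPhase.mem_nhds hy] with z hz
    simp [hu.gradPos_apply hz]
  have h3 := congrArg (fun l => l (EuclideanSpace.single i (1 : ℝ))) (h1.unique h2)
  simpa [iteratedFDeriv_two_apply] using h3

/-- The trace may be computed in any orthonormal basis; here it is split into a tangential and a
normal part. -/
lemma sum_coord_eq_inner_add_inner {e : Plane} (he : ‖e‖ = 1) (M : Plane →L[ℝ] Plane) :
    ∑ i : Fin 2, (M (EuclideanSpace.single i 1)) i = ⟪M (rot e), rot e⟫ + ⟪M e, e⟫ := by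
  have h := coord_sq_of_norm_one he
  have hv : ∀ v : Plane, M v = v 0 • M (EuclideanSpace.single 0 1) +
      v 1 • M (EuclideanSpace.single 1 1) := by
    intro v
    rw [← map_smul, ← map_smul, ← map_add]
    congr 1
    apply plane_ext <;> simp
  rw [hv e, hv (rot e), Fin.sum_univ_two]
  simp only [inner_eq_coord, rot_apply_zero, rot_apply_one, PiLp.add_apply, PiLp.smul_apply,
    smul_eq_mul]
  linear_combination (-(M (EuclideanSpace.single 0 1)) 0 - (M (EuclideanSpace.single 1 1)) 1) * h

lemma IsClassicalSolution.inner_fderivWithin_innerNormal (hu : IsClassicalSolution u) {p : Plane}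
    (hp : p ∈ freeBoundary u) (v : Plane) :
    ⟪fderivWithin ℝ (innerNormal u) (closure (posPhase u)) p v, gradPos u p⟫ = 0 := by
  rw [hu.fderivWithin_innerNormal hp, inner_sub_left, inner_smul_left, real_inner_self_eq_norm_sq,
    hu.norm_grad_eq_one p hp, real_inner_comm]
  simp

/-- The free boundary is convex towards the zero phase. -/
theorem IsClassicalSolution.meanCurvature_nonneg (hu : IsClassicalSolution u) {p : Plane}
    (hp : p ∈ freeBoundary u) : 0 ≤ meanCurvature u p := by
  have hpD := freeBoundary_subset_closure hp
  have hn := hu.norm_grad_eq_one p hp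
  set A := fderivWithin ℝ (gradPos u) (closure (posPhase u)) p with hA
  set w := gradPos u p with hw
  have htr := hu.trace_hessian_eq_zero hpD
  -- The divergence of the unit normal field is the tangential second derivative of `u`, and
  -- harmonicity makes it minus the normal one.
  have h1 : meanCurvature u p = -⟪A w, w⟫ := by
    rw [meanCurvature, sum_coord_eq_inner_add_inner hn,
      hu.inner_fderivWithin_innerNormal hp, hu.fderivWithin_innerNormal hp, inner_sub_left,
      inner_smul_left, real_inner_comm (rot w) (gradPos u p), ← hw, inner_rot_self]
    rw [sum_coord_eq_inner_add_inner hn, ← hA] at htr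
    simp only [mul_zero, sub_zero, add_zero, ← hA]
    linarith
  have hww : ⟪w, w⟫ = 1 := by rw [real_inner_self_eq_norm_sq, hn, one_pow]
  have hev : ∀ᶠ t in 𝓝[>] (0 : ℝ), p + t • w ∈ posPhase u :=
    hu.eventually_mem_posPhase hp (by rw [← hw, hww]; exact one_pos)
  have hlim := tendsto_slope_of_hasFDerivWithinAt (hu.hasFDerivWithinAt_gradPos hpD)
    (hev.mono fun t ht => subset_closure ht)
  have hlim' : Tendsto (fun t : ℝ => ⟪t⁻¹ • (gradPos u (p + t • w) - w), w⟫) (𝓝[>] 0)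
      (𝓝 ⟪A w, w⟫) := hlim.inner tendsto_const_nhds
  -- `⟪gradPos u, w⟫` is at most `1` and equals `1` at `p`, so its difference quotients into `Ω` are
  -- nonpositive.
  have : ⟪A w, w⟫ ≤ 0 := by
    refine le_of_tendsto hlim' ?_
    filter_upwards [hev, self_mem_nhdsWithin] with t ht ht0
    rw [inner_smul_left, inner_sub_left, hww]
    have h2 := real_inner_le_norm (gradPos u (p + t • w)) w
    have h3 := hu.norm_gradPos_le_one ⟨p, hp⟩ (subset_closure ht)
    rw [hn, mul_one] at h2
    simp only [map_inv₀, conj_trivial]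
    exact mul_nonpos_of_nonneg_of_nonpos (inv_nonneg.2 (le_of_lt ht0)) (by linarith)
  linarith

/-- Along the free boundary the inner normal turns with speed `H`. -/
lemma IsClassicalSolution.fderivWithin_innerNormal_rot (hu : IsClassicalSolution u) {p : Plane}
    (hp : p ∈ freeBoundary u) :
    fderivWithin ℝ (innerNormal u) (closure (posPhase u)) p (rot (gradPos u p)) =
      meanCurvature u p • rot (gradPos u p) := by
  have hn := hu.norm_grad_eq_one p hp
  rw [meanCurvature, sum_coord_eq_inner_add_inner hn, hu.inner_fderivWithin_innerNormal hp,
    add_zero]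
  conv_lhs => rw [← planePt_inner hn (fderivWithin ℝ (innerNormal u) (closure (posPhase u)) p
    (rot (gradPos u p)))]
  rw [hu.inner_fderivWithin_innerNormal hp, planePt, zero_smul, add_zero]

lemma IsClassicalSolution.continuousOn_meanCurvature (hu : IsClassicalSolution u) :
    ContinuousOn (meanCurvature u) (freeBoundary u) := by
  intro p hp
  have h1 : ContinuousWithinAt (fderivWithin ℝ (innerNormal u) (closure (posPhase u)))
      (closure (posPhase u)) p :=
    ((hu.contDiffWithinAt_innerNormal hp).fderivWithin_right (m := 0) hu.uniqueDiffOn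
      (by simp) (freeBoundary_subset_closure hp)).continuousWithinAt
  have h2 : ∀ i : Fin 2, ContinuousWithinAt (fun x =>
      (fderivWithin ℝ (innerNormal u) (closure (posPhase u)) x (EuclideanSpace.single i 1)) i)
      (closure (posPhase u)) p := fun i => by fun_prop
  refine ContinuousWithinAt.mono (t := closure (posPhase u)) ?_ freeBoundary_subset_closure
  unfold meanCurvature
  simp only [Fin.sum_univ_two]
  exact (h2 0).add (h2 1)

lemma IsClassicalSolution.continuousOn_innerNormal (hu : IsClassicalSolution u) :
    ContinuousOn (innerNormal u) (freeBoundary u) := fun _ hp =>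
  (hu.contDiffWithinAt_innerNormal hp).continuousWithinAt.mono freeBoundary_subset_closure

end Curvature

/-! ### Local parametrizations -/

section Param

variable {u : Plane → ℝ}

lemma hasDerivAt_planePt (e : Plane) {h : ℝ → ℝ} {h' s : ℝ} (hd : HasDerivAt h h' s) :
    HasDerivAt (fun s => planePt e s (h s)) (rot e + h' • e) s := by
  have := ((hasDerivAt_id s).smul_const (rot e)).add (hd.smul_const e)
  rw [one_smul] at this
  exact this

/-- A local graph parametrization of the free boundary with its slope. -/
lemma IsClassicalSolution.exists_graph (hu : IsClassicalSolution u) {p e : Plane}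
    (hp : p ∈ freeBoundary u) (he : ‖e‖ = 1) (hpe : 0 < ⟪gradPos u p, e⟫) :
    ∃ (h : ℝ → ℝ) (h' : ℝ), ContDiffAt ℝ 1 h ⟪p, rot e⟫ ∧ HasStrictDerivAt h h' ⟪p, rot e⟫ ∧
      h ⟪p, rot e⟫ = ⟪p, e⟫ ∧ ⟪gradPos u p, rot e⟫ + h' * ⟪gradPos u p, e⟫ = 0 ∧
      (∀ᶠ x in 𝓝 p, x ∈ freeBoundary u ↔ h ⟪x, rot e⟫ = ⟪x, e⟫) ∧
      (∀ᶠ s in 𝓝 ⟪p, rot e⟫, planePt e s (h s) ∈ freeBoundary u) := by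
  obtain ⟨h, hC, h0, hF⟩ := hu.exists_local_graph hp he hpe
  have hd : HasStrictDerivAt h (deriv h ⟪p, rot e⟫) ⟪p, rot e⟫ :=
    hC.hasStrictDerivAt one_ne_zero
  have hγ0 : planePt e ⟪p, rot e⟫ (h ⟪p, rot e⟫) = p := by rw [h0, planePt_inner he]
  have hγ : HasDerivAt (fun s => planePt e s (h s)) (rot e + deriv h ⟪p, rot e⟫ • e)
      ⟪p, rot e⟫ := by
    exact hasDerivAt_planePt e hd.hasDerivAt
  have hev : ∀ᶠ s in 𝓝 ⟪p, rot e⟫, planePt e s (h s) ∈ freeBoundary u := by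
    have ht : Tendsto (fun s => planePt e s (h s)) (𝓝 ⟪p, rot e⟫) (𝓝 p) := by
      have := hγ.continuousAt.tendsto
      rwa [hγ0] at this
    filter_upwards [ht.eventually hF] with s hs
    rw [hs, inner_planePt_rot he, inner_planePt he]
  refine ⟨h, _, hC, hd, h0, ?_, hF, hev⟩
  -- `u` vanishes along the graph, so differentiating it there gives the relation between the slope
  -- and the gradient.
  have hus : HasDerivAt (fun s => u (planePt e s (h s)))
      (innerSL ℝ (gradPos u p) (rot e + deriv h ⟪p, rot e⟫ • e)) ⟪p, rot e⟫ := by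
    have hg := hu.hasFDerivWithinAt (freeBoundary_subset_closure hp)
    rw [← hγ0] at hg
    have h1 := hg.comp_hasDerivWithinAt (s := {s | planePt e s (h s) ∈ freeBoundary u})
      ⟪p, rot e⟫ hγ.hasDerivWithinAt (fun s hs => freeBoundary_subset_closure hs)
    have h2 := h1.hasDerivAt hev
    rwa [hγ0] at h2
  have h0' : HasDerivAt (fun s => u (planePt e s (h s))) 0 ⟪p, rot e⟫ := by
    refine (hasDerivAt_const _ (0 : ℝ)).congr_of_eventuallyEq ?_
    filter_upwards [hev] with s hs using hu.eq_zero_of_mem_freeBoundary hs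
  have := hus.unique h0'
  simpa [inner_add_right, inner_smul_right] using this

lemma norm_sub_ge_inner_rot {e : Plane} (he : ‖e‖ = 1) (x y : Plane) :
    |⟪x, rot e⟫ - ⟪y, rot e⟫| ≤ ‖x - y‖ := by
  rw [← inner_sub_left]
  have := abs_real_inner_le_norm (x - y) (rot e)
  rwa [norm_rot, he, mul_one] at this

/-- The inner normal is locally Lipschitz along the free boundary with a constant close to the
curvature. -/
lemma IsClassicalSolution.exists_lipschitz_innerNormal (hu : IsClassicalSolution u) {p : Plane}
    (hp : p ∈ freeBoundary u) {ε : ℝ} (hε : 0 < ε) :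
    ∀ᶠ q in 𝓝 (p, p), q.1 ∈ freeBoundary u → q.2 ∈ freeBoundary u →
      ‖innerNormal u q.1 - innerNormal u q.2‖ ≤ (meanCurvature u p + ε) * ‖q.1 - q.2‖ := by
  set e := gradPos u p with hedef
  have he : ‖e‖ = 1 := hu.norm_grad_eq_one p hp
  have hee : ⟪e, e⟫ = 1 := by rw [real_inner_self_eq_norm_sq, he, one_pow]
  obtain ⟨h, h', hC, hd, h0, hslope, hF, hev⟩ := hu.exists_graph hp he (by
    rw [← hedef, hee]; exact one_pos)
  -- Over its own tangent line the graph is flat at `p`, so the parametrization has unit speed there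
  -- and the normal moves with speed exactly `H`.
  have hh' : h' = 0 := by
    rw [← hedef, hee, real_inner_comm, inner_rot_self] at hslope
    linarith
  subst hh'
  have hγ0 : planePt e ⟪p, rot e⟫ (h ⟪p, rot e⟫) = p := by rw [h0, planePt_inner he]
  have hγC : ContDiffAt ℝ 1 (fun s => planePt e s (h s)) ⟪p, rot e⟫ := by
    unfold planePt
    exact (contDiffAt_id.smul contDiffAt_const).add (hC.smul contDiffAt_const)
  have hγ : HasDerivAt (fun s => planePt e s (h s)) (rot e) ⟪p, rot e⟫ := by
    simpa using hasDerivAt_planePt e hd.hasDerivAt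
  have hNC : ContDiffAt ℝ 1 (fun s => innerNormal u (planePt e s (h s))) ⟪p, rot e⟫ := by
    have h1 := hu.contDiffWithinAt_innerNormal hp
    rw [← hγ0] at h1
    have h2 := (h1.of_le (m := 1) (by simp)).comp
      (s := {s | planePt e s (h s) ∈ freeBoundary u}) ⟪p, rot e⟫ hγC.contDiffWithinAt
      (fun s hs => freeBoundary_subset_closure hs)
    exact h2.contDiffAt hev
  have hNd : HasDerivAt (fun s => innerNormal u (planePt e s (h s)))
      (meanCurvature u p • rot e) ⟪p, rot e⟫ := by
    have hg := hu.hasFDerivWithinAt_innerNormal hp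
    rw [← hγ0] at hg
    have h1 := hg.comp_hasDerivWithinAt (s := {s | planePt e s (h s) ∈ freeBoundary u})
      ⟪p, rot e⟫ hγ.hasDerivWithinAt (fun s hs => freeBoundary_subset_closure hs)
    have h2 := h1.hasDerivAt hev
    rwa [hγ0, hu.fderivWithin_innerNormal_rot hp] at h2
  -- Strictness is essential: the estimate must compare two nearby points, neither of which need be
  -- `p`.
  have hstrict : HasStrictDerivAt (fun s => innerNormal u (planePt e s (h s)))
      (meanCurvature u p • rot e) ⟪p, rot e⟫ := hNC.hasStrictDerivAt' hNd one_ne_zero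
  have hlip : ∀ᶠ q in 𝓝 (⟪p, rot e⟫, ⟪p, rot e⟫),
      ‖innerNormal u (planePt e q.1 (h q.1)) - innerNormal u (planePt e q.2 (h q.2))‖ ≤
        (meanCurvature u p + ε) * ‖q.1 - q.2‖ := by
    have h1 := hstrict.isLittleO.def hε
    filter_upwards [h1] with q hq
    rw [ContinuousLinearMap.toSpanSingleton_apply] at hq
    have h2 := norm_le_norm_add_norm_sub' (innerNormal u (planePt e q.1 (h q.1)) -
      innerNormal u (planePt e q.2 (h q.2))) ((q.1 - q.2) • meanCurvature u p • rot e)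
    have h3 : ‖(q.1 - q.2) • meanCurvature u p • rot e‖ = meanCurvature u p * ‖q.1 - q.2‖ := by
      rw [norm_smul, norm_smul, norm_rot, he, Real.norm_of_nonneg (hu.meanCurvature_nonneg hp)]
      ring
    rw [h3] at h2
    linarith
  have hcoord : Tendsto (fun q : Plane × Plane => (⟪q.1, rot e⟫, ⟪q.2, rot e⟫)) (𝓝 (p, p))
      (𝓝 (⟪p, rot e⟫, ⟪p, rot e⟫)) := by
    have : Continuous fun q : Plane × Plane => (⟪q.1, rot e⟫, ⟪q.2, rot e⟫) := by fun_prop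
    exact this.tendsto (p, p)
  have hF1 : ∀ᶠ q in 𝓝 (p, p), q.1 ∈ freeBoundary u ↔ h ⟪q.1, rot e⟫ = ⟪q.1, e⟫ :=
    (continuous_fst.tendsto (p, p)).eventually hF
  have hF2 : ∀ᶠ q in 𝓝 (p, p), q.2 ∈ freeBoundary u ↔ h ⟪q.2, rot e⟫ = ⟪q.2, e⟫ :=
    (continuous_snd.tendsto (p, p)).eventually hF
  filter_upwards [hF1, hF2, hcoord.eventually hlip] with q hq1 hq2 hq hm1 hm2
  rw [hq1.1 hm1, hq2.1 hm2, planePt_inner he, planePt_inner he] at hq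
  refine hq.trans ?_
  have := hu.meanCurvature_nonneg hp
  exact mul_le_mul_of_nonneg_left (norm_sub_ge_inner_rot he q.1 q.2) (by linarith)

/-- The free boundary has locally finite length. -/
lemma IsClassicalSolution.exists_hausdorffMeasure_lt_top (hu : IsClassicalSolution u) {p : Plane}
    (hp : p ∈ freeBoundary u) :
    ∃ U ∈ 𝓝 p, (Measure.hausdorffMeasure 1 : Measure Plane) (freeBoundary u ∩ U) < ⊤ := by
  set e := gradPos u p with hedef
  have he : ‖e‖ = 1 := hu.norm_grad_eq_one p hp
  have hee : ⟪e, e⟫ = 1 := by rw [real_inner_self_eq_norm_sq, he, one_pow]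
  obtain ⟨h, hC, h0, hF⟩ := hu.exists_local_graph hp he (by rw [← hedef, hee]; exact one_pos)
  have hγC : ContDiffAt ℝ 1 (fun s => planePt e s (h s)) ⟪p, rot e⟫ := by
    unfold planePt
    exact (contDiffAt_id.smul contDiffAt_const).add (hC.smul contDiffAt_const)
  obtain ⟨K, t, ht, hK⟩ := hγC.exists_lipschitzOnWith
  obtain ⟨δ, hδ, hball⟩ := Metric.mem_nhds_iff.1 ht
  have hcoord : Tendsto (fun x : Plane => ⟪x, rot e⟫) (𝓝 p) (𝓝 ⟪p, rot e⟫) := by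
    have : Continuous fun x : Plane => ⟪x, rot e⟫ := by fun_prop
    exact this.tendsto p
  refine ⟨_, hF.and (hcoord.eventually (Metric.ball_mem_nhds _ hδ)), ?_⟩
  have hsub : freeBoundary u ∩ {x | (x ∈ freeBoundary u ↔ h ⟪x, rot e⟫ = ⟪x, e⟫) ∧
      ⟪x, rot e⟫ ∈ Metric.ball ⟪p, rot e⟫ δ} ⊆
      (fun s => planePt e s (h s)) '' Metric.ball ⟪p, rot e⟫ δ := by
    rintro x ⟨hxF, hx1, hx2⟩
    exact ⟨⟪x, rot e⟫, hx2, by simp only [hx1.1 hxF, planePt_inner he]⟩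
  refine (measure_mono hsub).trans_lt ?_
  refine ((hK.mono hball).hausdorffMeasure_image_le zero_le_one).trans_lt ?_
  rw [hausdorffMeasure_real]
  exact ENNReal.mul_lt_top (by simp) measure_ball_lt_top

lemma IsClassicalSolution.hausdorffMeasure_inter_compact_lt_top (hu : IsClassicalSolution u)
    {K : Set Plane} (hK : IsCompact K) :
    (Measure.hausdorffMeasure 1 : Measure Plane) (freeBoundary u ∩ K) < ⊤ := by
  have hc : IsCompact (freeBoundary u ∩ K) := hK.inter_left isClosed_freeBoundary
  have := hc.measure_lt_top_of_nhdsWithin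
    (μ := (Measure.hausdorffMeasure 1 : Measure Plane).restrict (freeBoundary u)) ?_
  · rwa [Measure.restrict_apply hc.measurableSet,
      inter_eq_left.2 inter_subset_left] at this
  · intro p hp
    obtain ⟨U, hU, hlt⟩ := hu.exists_hausdorffMeasure_lt_top hp.1
    obtain ⟨V, hVU, hV, hpV⟩ := mem_nhds_iff.1 hU
    refine ⟨V, mem_nhdsWithin_of_mem_nhds (hV.mem_nhds hpV), ?_⟩
    rw [Measure.restrict_apply hV.measurableSet, inter_comm]
    exact (measure_mono (inter_subset_inter_right _ hVU)).trans_lt hlt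

end Param

/-! ### Total curvature controls the variation of the normal -/

section GaussMap

open scoped NNReal ENNReal

/-- A map that is locally Lipschitz on `F`, with local constants at most `ρ + ε`, increases the
one-dimensional measure at most by the density `ρ`. -/
lemma hausdorffMeasure_image_le_lintegral {X Y : Type*} [MetricSpace X] [MeasurableSpace X]
    [BorelSpace X] [SecondCountableTopology X] [MetricSpace Y] [MeasurableSpace Y] [BorelSpace Y]
    {F E : Set X} {f : X → Y} {ρ : X → ℝ≥0∞} (hEF : E ⊆ F) (hE : MeasurableSet E)
    (hfin : (Measure.hausdorffMeasure 1 : Measure X) E ≠ ⊤)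
    (hloc : ∀ p ∈ F, ∀ ε : ℝ≥0, 0 < ε → ∃ U : Set X, IsOpen U ∧ p ∈ U ∧ ∃ K : ℝ≥0,
      LipschitzOnWith K f (F ∩ U) ∧ ∀ x ∈ F ∩ U, (K : ℝ≥0∞) ≤ ρ x + ε) :
    (Measure.hausdorffMeasure 1 : Measure Y) (f '' E) ≤
      ∫⁻ x in E, ρ x ∂(Measure.hausdorffMeasure 1) := by
  set μ : Measure X := Measure.hausdorffMeasure 1
  rcases E.eq_empty_or_nonempty with rfl | hne
  · simp
  have main : ∀ ε : ℝ≥0, 0 < ε →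
      (Measure.hausdorffMeasure 1 : Measure Y) (f '' E) ≤ ∫⁻ x in E, ρ x ∂μ + ε * μ E := by
    intro ε hε
    choose! U hUo hpU K hK hKρ using fun p hp => hloc p hp ε hε
    obtain ⟨t, htE, htc, hcov⟩ := TopologicalSpace.countable_cover_nhdsWithin
      (s := E) (f := U) fun x hx => mem_nhdsWithin_of_mem_nhds
        ((hUo x (hEF hx)).mem_nhds (hpU x (hEF hx)))
    have htne : t.Nonempty := by
      obtain ⟨x, hx⟩ := hne
      obtain ⟨y, hy, -⟩ := mem_iUnion₂.1 (hcov hx)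
      exact ⟨y, hy⟩
    obtain ⟨g, rfl⟩ := htc.exists_eq_range htne
    have hgF : ∀ n, g n ∈ F := fun n => hEF (htE (mem_range_self n))
    -- Disjoint pieces let the local estimates add up to one integral over `E`.
    let W : ℕ → Set X := fun n => E ∩ disjointed (fun n => U (g n)) n
    have hWm : ∀ n, MeasurableSet (W n) := fun n =>
      hE.inter (MeasurableSet.disjointed (fun n => (hUo _ (hgF n)).measurableSet) n)
    have hWU : ∀ n, W n ⊆ F ∩ U (g n) := fun n x hx =>
      ⟨hEF hx.1, disjointed_subset (fun n => U (g n)) n hx.2⟩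
    have hWd : Pairwise (Function.onFun Disjoint W) := fun i j hij =>
      (disjoint_disjointed (fun n => U (g n)) hij).mono inter_subset_right inter_subset_right
    have hWE : ⋃ n, W n = E := by
      rw [← inter_iUnion, iUnion_disjointed]
      refine inter_eq_left.2 fun x hx => ?_
      have := hcov hx
      simpa using this
    calc (Measure.hausdorffMeasure 1 : Measure Y) (f '' E)
        = (Measure.hausdorffMeasure 1 : Measure Y) (⋃ n, f '' W n) := by
          rw [← image_iUnion, hWE]
      _ ≤ ∑' n, (Measure.hausdorffMeasure 1 : Measure Y) (f '' W n) := measure_iUnion_le _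
      _ ≤ ∑' n, ∫⁻ x in W n, (ρ x + ε) ∂μ := by
          refine ENNReal.tsum_le_tsum fun n => ?_
          have h1 := ((hK _ (hgF n)).mono (hWU n)).hausdorffMeasure_image_le zero_le_one
          rw [ENNReal.rpow_one] at h1
          refine h1.trans ?_
          rw [← setLIntegral_const]
          exact setLIntegral_mono' (hWm n) fun x hx => hKρ _ (hgF n) x (hWU n hx)
      _ = ∫⁻ x in E, (ρ x + ε) ∂μ := by
          rw [← lintegral_iUnion hWm hWd, hWE]
      _ = ∫⁻ x in E, ρ x ∂μ + ε * μ E := by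
          rw [lintegral_add_right _ measurable_const, setLIntegral_const]
  refine ENNReal.le_of_forall_pos_le_add fun δ hδ _ => ?_
  lift μ E to ℝ≥0 using hfin with m hm
  obtain ⟨ε, hε, hεm⟩ : ∃ ε : ℝ≥0, 0 < ε ∧ ε * m ≤ δ := by
    refine ⟨δ / (m + 1), by positivity, ?_⟩
    rw [div_mul_eq_mul_div, div_le_iff₀ (by positivity)]
    gcongr
    simp
  refine (main ε hε).trans ?_
  gcongr
  exact_mod_cast hεm

/-- The length of a connected set is at least the distance between any two of its points. -/
lemma edist_le_hausdorffMeasure {X : Type*} [MetricSpace X] [MeasurableSpace X] [BorelSpace X]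
    {C : Set X} (hC : IsPreconnected C) {a b : X} (ha : a ∈ C) (hb : b ∈ C) :
    edist a b ≤ (Measure.hausdorffMeasure 1 : Measure X) C := by
  -- The distance to `a` does not increase length and maps `C` onto a set containing the interval
  -- from `0` to `dist b a`.
  have hl : LipschitzWith 1 fun x => dist x a := LipschitzWith.dist_left a
  have hpre : IsPreconnected ((fun x => dist x a) '' C) := hC.image _ hl.continuous.continuousOn
  have hsub : Icc 0 (dist b a) ⊆ (fun x => dist x a) '' C :=
    hpre.Icc_subset ⟨a, ha, by simp⟩ ⟨b, hb, rfl⟩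
  calc edist a b = volume (Icc 0 (dist b a)) := by
        rw [Real.volume_Icc, sub_zero, ← edist_dist, edist_comm]
    _ = (Measure.hausdorffMeasure 1 : Measure ℝ) (Icc 0 (dist b a)) := by rw [hausdorffMeasure_real]
    _ ≤ (Measure.hausdorffMeasure 1 : Measure ℝ) ((fun x => dist x a) '' C) := measure_mono hsub
    _ ≤ _ := by simpa using hl.hausdorffMeasure_image_le zero_le_one C

variable {u : Plane → ℝ}

/-- The normals at two points of a connected piece of the free boundary differ at most by its total
curvature. -/
theorem IsClassicalSolution.edist_innerNormal_le (hu : IsClassicalSolution u) {C : Set Plane}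
    (hCF : C ⊆ freeBoundary u) (hC : IsPreconnected C) (hm : MeasurableSet C) {a b : Plane}
    (ha : a ∈ C) (hb : b ∈ C) :
    edist (innerNormal u a) (innerNormal u b) ≤
      ∫⁻ x in C, ENNReal.ofReal (meanCurvature u x) ∂(Measure.hausdorffMeasure 1) := by
  have hN : IsPreconnected (innerNormal u '' C) := hC.image _ (hu.continuousOn_innerNormal.mono hCF)
  refine (edist_le_hausdorffMeasure hN (mem_image_of_mem _ ha) (mem_image_of_mem _ hb)).trans ?_
  have hloc : ∀ p ∈ freeBoundary u, ∀ ε : ℝ≥0, 0 < ε → ∃ U : Set Plane, IsOpen U ∧ p ∈ U ∧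
      ∃ K : ℝ≥0, LipschitzOnWith K (innerNormal u) (freeBoundary u ∩ U) ∧
        ∀ x ∈ freeBoundary u ∩ U, (K : ℝ≥0∞) ≤ ENNReal.ofReal (meanCurvature u x) + ε := by
    intro p hp ε hε
    -- One half of `ε` is spent on the Lipschitz constant at `p`, the other on the variation of `H`
    -- near `p`.
    have hε' : (0 : ℝ) < ε / 2 := by positivity
    have h1 := hu.exists_lipschitz_innerNormal hp hε'
    rw [nhds_prod_eq] at h1
    obtain ⟨V, hV, hVl⟩ := eventually_prod_self_iff'.1 h1
    have h2 : ∀ᶠ x in 𝓝[freeBoundary u] p, meanCurvature u p - ε / 2 < meanCurvature u x :=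
      (hu.continuousOn_meanCurvature p hp).eventually (lt_mem_nhds (by linarith))
    obtain ⟨W, hW, hpW, hWl⟩ := mem_nhdsWithin.1 h2
    obtain ⟨V', hV'V, hV', hpV'⟩ := mem_nhds_iff.1 hV
    refine ⟨V' ∩ W, hV'.inter hW, ⟨hpV', hpW⟩, (meanCurvature u p + ε / 2).toNNReal, ?_, ?_⟩
    · refine LipschitzOnWith.of_dist_le_mul fun x hx y hy => ?_
      rw [dist_eq_norm, dist_eq_norm, Real.coe_toNNReal _
        (by linarith [hu.meanCurvature_nonneg hp])]
      exact hVl x (hV'V hx.2.1) y (hV'V hy.2.1) hx.1 hy.1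
    · intro x hx
      have h3 : meanCurvature u p - ε / 2 < meanCurvature u x := hWl ⟨hx.2.2, hx.1⟩
      rw [← ENNReal.ofReal_coe_nnreal (p := ε), ← ENNReal.ofReal_add
        (hu.meanCurvature_nonneg hx.1) ε.coe_nonneg]
      exact ENNReal.ofReal_le_ofReal (by linarith)
  -- The measure estimate needs finite length, which an unbounded component may lack; hence the
  -- exhaustion by balls.
  have hunion : innerNormal u '' C = ⋃ n : ℕ, innerNormal u '' (C ∩ Metric.closedBall 0 n) := by
    rw [← image_iUnion, ← inter_iUnion, Metric.iUnion_closedBall_nat, inter_univ]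
  have hmono : Monotone fun n : ℕ => innerNormal u '' (C ∩ Metric.closedBall 0 n) :=
    fun i j hij => image_mono (inter_subset_inter_right _
      (Metric.closedBall_subset_closedBall (by exact_mod_cast hij)))
  rw [hunion, hmono.measure_iUnion]
  refine iSup_le fun n => ?_
  refine (hausdorffMeasure_image_le_lintegral (F := freeBoundary u)
    (inter_subset_left.trans hCF) (hm.inter Metric.isClosed_closedBall.measurableSet) ?_
    hloc).trans (lintegral_mono_set inter_subset_left)
  exact ((measure_mono (inter_subset_inter_left _ hCF)).trans_lt
    (hu.hausdorffMeasure_inter_compact_lt_top (isCompact_closedBall 0 _))).ne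

end GaussMap

/-! ### Closed sets that are local graphs -/

section LocalGraph

/-- `G` is near each of its points the graph of a `3`-Lipschitz function. -/
def IsLocalGraph (G : Set (ℝ × ℝ)) : Prop :=
  ∀ q ∈ G, ∃ h : ℝ → ℝ, ∃ δ > 0, LipschitzOnWith 3 h (Metric.ball q.1 δ) ∧ h q.1 = q.2 ∧
    (∀ s ∈ Metric.ball q.1 δ, (s, h s) ∈ G) ∧ ∀ᶠ z in 𝓝 q, z ∈ G → h z.1 = z.2

lemma continuousOn_ite_Icc {k k' : ℝ → ℝ} {a t c : ℝ} (hk : ContinuousOn k (Icc a t))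
    (hk' : ContinuousOn k' (Icc t c)) (h : k t = k' t) :
    ContinuousOn (fun s => if s ≤ t then k s else k' s) (Icc a t ∪ Icc t c) := by
  refine ContinuousOn.union_of_isClosed ?_ ?_ isClosed_Icc isClosed_Icc
  · exact hk.congr fun s hs => by simp [hs.2]
  · refine hk'.congr fun s hs => ?_
    rcases hs.1.eq_or_lt with rfl | hlt
    · simp [h]
    · simp [not_le.2 hlt]

/-- On compact parts of a local graph, the local graphs extend by a uniform amount. -/
lemma IsLocalGraph.exists_uniform {G : Set (ℝ × ℝ)} (hG : IsLocalGraph G) {K : Set (ℝ × ℝ)}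
    (hK : IsCompact K) (hKG : K ⊆ G) :
    ∃ δ > 0, ∀ q ∈ K, ∃ h : ℝ → ℝ, LipschitzOnWith 3 h (Icc q.1 (q.1 + δ)) ∧ h q.1 = q.2 ∧
      ∀ s ∈ Icc q.1 (q.1 + δ), (s, h s) ∈ G := by
  refine hK.induction_on (p := fun S => ∃ δ > 0, ∀ q ∈ S, ∃ h : ℝ → ℝ,
    LipschitzOnWith 3 h (Icc q.1 (q.1 + δ)) ∧ h q.1 = q.2 ∧
      ∀ s ∈ Icc q.1 (q.1 + δ), (s, h s) ∈ G) ⟨1, one_pos, by simp⟩ ?_ ?_ ?_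
  · rintro S T hST ⟨δ, hδ, h⟩
    exact ⟨δ, hδ, fun q hq => h q (hST hq)⟩
  · rintro S T ⟨δ, hδ, h⟩ ⟨δ', hδ', h'⟩
    have hsub : ∀ q : ℝ × ℝ, Icc q.1 (q.1 + min δ δ') ⊆ Icc q.1 (q.1 + δ) := fun q =>
      Icc_subset_Icc_right (by simp)
    have hsub' : ∀ q : ℝ × ℝ, Icc q.1 (q.1 + min δ δ') ⊆ Icc q.1 (q.1 + δ') := fun q =>
      Icc_subset_Icc_right (by simp)
    refine ⟨min δ δ', lt_min hδ hδ', fun q hq => ?_⟩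
    rcases hq with hq | hq
    · obtain ⟨k, k1, k2, k3⟩ := h q hq
      exact ⟨k, k1.mono (hsub q), k2, fun s hs => k3 s (hsub q hs)⟩
    · obtain ⟨k, k1, k2, k3⟩ := h' q hq
      exact ⟨k, k1.mono (hsub' q), k2, fun s hs => k3 s (hsub' q hs)⟩
  · intro q hq
    obtain ⟨h, δ, hδ, hl, h0, hgr, huni⟩ := hG q (hKG hq)
    have hball : ∀ᶠ z in 𝓝 q, z.1 ∈ Metric.ball q.1 (δ / 2) :=
      (continuous_fst.tendsto q).eventually (Metric.ball_mem_nhds _ (by positivity))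
    refine ⟨{z | z ∈ K ∧ (z ∈ G → h z.1 = z.2) ∧ z.1 ∈ Metric.ball q.1 (δ / 2)}, ?_, δ / 4,
      by positivity, ?_⟩
    · filter_upwards [self_mem_nhdsWithin, nhdsWithin_le_nhds huni, nhdsWithin_le_nhds hball]
        with z h1 h2 h3 using ⟨h1, h2, h3⟩
    · rintro z ⟨hzK, hz, hzb⟩
      have hsub : Icc z.1 (z.1 + δ / 4) ⊆ Metric.ball q.1 δ := by
        intro s hs
        rw [Metric.mem_ball, Real.dist_eq, abs_lt] at hzb ⊢
        constructor <;> linarith [hs.1, hs.2, hzb.1, hzb.2]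
      exact ⟨h, hl.mono hsub, hz (hKG hzK), fun s hs => hgr s (hsub hs)⟩

/-- Continuation in steps of a fixed size. The slope bound `3` confines the graph over an interval
of length `T` to a compact box, and on the compact part of `G` in that box all local graphs extend
by the same `δ`. -/
lemma IsLocalGraph.exists_lift_right {G : Set (ℝ × ℝ)} (hG : IsLocalGraph G) (hc : IsClosed G)
    {q : ℝ × ℝ} (hq : q ∈ G) {T : ℝ} (hT : 0 ≤ T) :
    ∃ k : ℝ → ℝ, ContinuousOn k (Icc q.1 (q.1 + T)) ∧ k q.1 = q.2 ∧
      ∀ s ∈ Icc q.1 (q.1 + T), (s, k s) ∈ G := by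
  set K : Set (ℝ × ℝ) := G ∩ (Icc q.1 (q.1 + T) ×ˢ Icc (q.2 - 3 * T) (q.2 + 3 * T)) with hK
  have hKc : IsCompact K := (isCompact_Icc.prod isCompact_Icc).inter_left hc
  obtain ⟨δ, hδ, hext⟩ := hG.exists_uniform hKc inter_subset_left
  have step : ∀ n : ℕ, ∃ k : ℝ → ℝ, ContinuousOn k (Icc q.1 (q.1 + min (n * δ) T)) ∧
      k q.1 = q.2 ∧ ∀ s ∈ Icc q.1 (q.1 + min (n * δ) T),
        (s, k s) ∈ G ∧ |k s - q.2| ≤ 3 * (s - q.1) := by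
    intro n
    induction n with
    | zero =>
      refine ⟨fun _ => q.2, continuousOn_const, rfl, fun s hs => ?_⟩
      have : s = q.1 := by
        have := hs.2
        simp only [Nat.cast_zero, zero_mul, min_eq_left hT, add_zero] at this
        exact le_antisymm this hs.1
      subst this
      exact ⟨hq, by simp⟩
    | succ n ih =>
      obtain ⟨k, hk, hk0, hkG⟩ := ih
      set t := q.1 + min (n * δ) T with ht
      have ht0 : q.1 ≤ t := by
        have : 0 ≤ min (n * δ) T := le_min (by positivity) hT
        linarith
      have htT : t ≤ q.1 + T := by simp [ht]
      obtain ⟨htG, htb⟩ := hkG t ⟨ht0, le_rfl⟩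
      have htK : (t, k t) ∈ K := by
        refine ⟨htG, ⟨ht0, htT⟩, ?_⟩
        rw [abs_le] at htb
        constructor <;> simp only <;> linarith [htb.1, htb.2]
      obtain ⟨k', hk'l, hk'0, hk'G⟩ := hext _ htK
      simp only at hk'l hk'0 hk'G
      have htt : q.1 + min ((n + 1 : ℕ) * δ) T ≤ t + δ := by
        rw [ht, add_assoc, min_add]
        push_cast
        gcongr
        · linarith
        · linarith
      have hsub : Icc q.1 (q.1 + min ((n + 1 : ℕ) * δ) T) ⊆ Icc q.1 t ∪ Icc t (t + δ) := by
        intro s hs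
        rcases le_total s t with h | h
        · exact Or.inl ⟨hs.1, h⟩
        · exact Or.inr ⟨h, hs.2.trans htt⟩
      refine ⟨fun s => if s ≤ t then k s else k' s,
        (continuousOn_ite_Icc hk hk'l.continuousOn hk'0.symm).mono hsub, by simp [ht0, hk0], ?_⟩
      intro s hs
      by_cases hst : s ≤ t
      · simp only [hst, if_true]
        exact hkG s ⟨hs.1, hst⟩
      · simp only [hst, if_false]
        push Not at hst
        have hs' : s ∈ Icc t (t + δ) := ⟨hst.le, hs.2.trans htt⟩
        refine ⟨hk'G s hs', ?_⟩
        have h1 := hk'l.dist_le_mul s hs' t ⟨le_rfl, by linarith⟩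
        rw [Real.dist_eq, Real.dist_eq, hk'0, abs_of_pos (sub_pos.2 hst)] at h1
        have h2 := abs_sub_le (k' s) (k t) q.2
        norm_num at h1
        linarith
  obtain ⟨n, hn⟩ := exists_nat_ge (T / δ)
  have hnT : min (n * δ) T = T := min_eq_right ((div_le_iff₀ hδ).1 hn)
  obtain ⟨k, h1, h2, h3⟩ := step n
  rw [hnT] at h1 h3
  exact ⟨k, h1, h2, fun s hs => (h3 s hs).1⟩

/-- Reduces continuation to the left to continuation to the right. -/
lemma IsLocalGraph.reflect {G : Set (ℝ × ℝ)} (hG : IsLocalGraph G) :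
    IsLocalGraph {z | (-z.1, z.2) ∈ G} := by
  intro q hq
  obtain ⟨h, δ, hδ, hl, h0, hgr, huni⟩ := hG _ hq
  have hneg : ∀ s ∈ Metric.ball q.1 δ, -s ∈ Metric.ball (-q.1) δ := fun s hs => by
    rwa [Metric.mem_ball, dist_neg_neg]
  refine ⟨fun s => h (-s), δ, hδ, ?_, h0, fun s hs => hgr _ (hneg s hs), ?_⟩
  · refine LipschitzOnWith.of_dist_le_mul fun x hx y hy => ?_
    have := hl.dist_le_mul _ (hneg x hx) _ (hneg y hy)
    rwa [dist_neg_neg] at this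
  · have ht : Tendsto (fun z : ℝ × ℝ => (-z.1, z.2)) (𝓝 q) (𝓝 (-q.1, q.2)) := by
      have : Continuous fun z : ℝ × ℝ => (-z.1, z.2) := by fun_prop
      exact this.tendsto q
    exact ht.eventually huni

lemma IsLocalGraph.exists_lift {G : Set (ℝ × ℝ)} (hG : IsLocalGraph G) (hc : IsClosed G)
    {q : ℝ × ℝ} (hq : q ∈ G) {T : ℝ} (hT : 0 ≤ T) :
    ∃ k : ℝ → ℝ, ContinuousOn k (Icc (q.1 - T) (q.1 + T)) ∧ k q.1 = q.2 ∧
      ∀ s ∈ Icc (q.1 - T) (q.1 + T), (s, k s) ∈ G := by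
  obtain ⟨k, k1, k2, k3⟩ := hG.exists_lift_right hc hq hT
  have hc' : IsClosed {z : ℝ × ℝ | (-z.1, z.2) ∈ G} := hc.preimage (by fun_prop)
  obtain ⟨l, l1, l2, l3⟩ := hG.reflect.exists_lift_right hc' (q := (-q.1, q.2))
    (by simpa using hq) hT
  simp only at l1 l2 l3
  have hneg : ∀ s ∈ Icc (q.1 - T) q.1, -s ∈ Icc (-q.1) (-q.1 + T) := fun s hs =>
    ⟨by linarith [hs.2], by linarith [hs.1]⟩
  have hl : ContinuousOn (fun s => l (-s)) (Icc (q.1 - T) q.1) :=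
    l1.comp continuous_neg.continuousOn hneg
  have hsub : Icc (q.1 - T) (q.1 + T) ⊆ Icc (q.1 - T) q.1 ∪ Icc q.1 (q.1 + T) := by
    intro s hs
    rcases le_total s q.1 with h | h
    · exact Or.inl ⟨hs.1, h⟩
    · exact Or.inr ⟨h, hs.2⟩
  refine ⟨fun s => if s ≤ q.1 then l (-s) else k s,
    (continuousOn_ite_Icc hl k1 (by rw [l2, k2])).mono hsub, by simp [l2], fun s hs => ?_⟩
  by_cases h : s ≤ q.1
  · simp only [h, if_true]
    simpa using l3 (-s) (hneg s ⟨hs.1, h⟩)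
  · simp only [h, if_false]
    exact k3 s ⟨(not_le.1 h).le, hs.2⟩

/-- The first coordinate is locally injective on `G`, so two continuous lifts of a connected
interval that agree at one point agree everywhere. -/
lemma IsLocalGraph.lift_unique {G : Set (ℝ × ℝ)} (hG : IsLocalGraph G) {a b c : ℝ}
    {k l : ℝ → ℝ} (hk : ContinuousOn k (Icc a b)) (hl : ContinuousOn l (Icc a b))
    (hkG : ∀ s ∈ Icc a b, (s, k s) ∈ G) (hlG : ∀ s ∈ Icc a b, (s, l s) ∈ G)
    (hc : c ∈ Icc a b) (h : k c = l c) : EqOn k l (Icc a b) := by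
  have hinj : IsLocallyInjective fun z : G => z.1.1 := by
    rw [isLocallyInjective_iff_nhds]
    intro z
    obtain ⟨g, δ, hδ, -, -, -, huni⟩ := hG z.1 z.2
    refine ⟨_, (continuous_subtype_val.tendsto z).eventually huni, ?_⟩
    intro x hx y hy hxy
    have h1 : g x.1.1 = x.1.2 := hx x.2
    have h2 : g y.1.1 = y.1.2 := hy y.2
    have hxy' : x.1.1 = y.1.1 := hxy
    exact Subtype.ext (Prod.ext hxy' (by rw [← h1, ← h2, hxy']))
  let lift (m : ℝ → ℝ) (hm : ∀ s ∈ Icc a b, (s, m s) ∈ G) : Icc a b → G :=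
    fun s => ⟨(s.1, m s.1), hm s.1 s.2⟩
  have hcont : ∀ m (hm : ∀ s ∈ Icc a b, (s, m s) ∈ G), ContinuousOn m (Icc a b) →
      Continuous (lift m hm) := fun m hm hmc =>
    (continuous_subtype_val.prodMk (continuousOn_iff_continuous_domRestrict.1 hmc)).subtype_mk _
  have : PreconnectedSpace (Icc a b) := Subtype.preconnectedSpace isPreconnected_Icc
  have := (T2Space.isSeparatedMap fun z : G => z.1.1).eq_of_comp_eq hinj (hcont k hkG hk)
    (hcont l hlG hl) (by ext s; rfl) ⟨c, hc⟩ (Subtype.ext (Prod.ext rfl h))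
  intro s hs
  have h1 := congrFun this ⟨s, hs⟩
  exact congrArg (fun z : G => z.1.2) h1

/-- Through each point of a closed local graph passes an entire graph. -/
theorem IsLocalGraph.exists_entire {G : Set (ℝ × ℝ)} (hG : IsLocalGraph G) (hc : IsClosed G)
    {q : ℝ × ℝ} (hq : q ∈ G) :
    ∃ h : ℝ → ℝ, Continuous h ∧ h q.1 = q.2 ∧ ∀ s, (s, h s) ∈ G := by
  choose k hk hk0 hkG using fun n : ℕ => hG.exists_lift hc hq (Nat.cast_nonneg (α := ℝ) n)
  have hagree : ∀ m n : ℕ, m ≤ n → EqOn (k m) (k n) (Icc (q.1 - m) (q.1 + m)) := by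
    intro m n hmn
    have hmn' : (m : ℝ) ≤ n := by exact_mod_cast hmn
    have hsub : Icc (q.1 - m) (q.1 + m) ⊆ Icc (q.1 - n) (q.1 + n) :=
      Icc_subset_Icc (by linarith) (by linarith)
    have hm0 : (0 : ℝ) ≤ m := Nat.cast_nonneg m
    exact hG.lift_unique (hk m) ((hk n).mono hsub) (hkG m) (fun s hs => hkG n s (hsub hs))
      (c := q.1) ⟨by linarith, by linarith⟩ (by rw [hk0, hk0])
  -- The entire graph at `s` is read off from the first lift whose interval contains `s`; `hagree`
  -- makes any later lift give the same value.
  let N : ℝ → ℕ := fun s => ⌈|s - q.1|⌉₊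
  have hN : ∀ s, s ∈ Icc (q.1 - N s) (q.1 + N s) := by
    intro s
    have h1 : |s - q.1| ≤ N s := Nat.le_ceil _
    rw [abs_le] at h1
    exact ⟨by linarith [h1.1], by linarith [h1.2]⟩
  have heq : ∀ (n : ℕ) s, |s - q.1| ≤ n → k (N s) s = k n s := fun n s hs =>
    hagree _ _ (Nat.ceil_le.2 hs) (hN s)
  refine ⟨fun s => k (N s) s, ?_, hk0 _, fun s => hkG _ _ (hN s)⟩
  rw [continuous_iff_continuousAt]
  intro s
  obtain ⟨n, hn⟩ := exists_nat_gt |s - q.1|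
  have hev : ∀ᶠ t in 𝓝 s, |t - q.1| < n := by
    have : Continuous fun t : ℝ => |t - q.1| := by fun_prop
    exact (this.tendsto s).eventually (gt_mem_nhds hn)
  have hmem : Icc (q.1 - n) (q.1 + n) ∈ 𝓝 s := by
    filter_upwards [hev] with t ht
    rw [abs_lt] at ht
    exact ⟨by linarith [ht.1], by linarith [ht.2]⟩
  refine ((hk n).continuousAt hmem).congr ?_
  filter_upwards [hev] with t ht using (heq n t ht.le).symm

end LocalGraph

/-! ### Components of the free boundary -/

section Components

variable {u : Plane → ℝ}

/-- Over a small interval the graph is a connected subset of `F(u)` through `p`, hence stays in the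
component of `p`. -/
lemma IsClassicalSolution.exists_graph_subset_component (hu : IsClassicalSolution u)
    {p e : Plane} (hp : p ∈ freeBoundary u) (he : ‖e‖ = 1) (hpe : 0 < ⟪gradPos u p, e⟫) :
    ∃ (h : ℝ → ℝ) (h' : ℝ), HasStrictDerivAt h h' ⟪p, rot e⟫ ∧ h ⟪p, rot e⟫ = ⟪p, e⟫ ∧
      ⟪gradPos u p, rot e⟫ + h' * ⟪gradPos u p, e⟫ = 0 ∧
      (∀ᶠ x in 𝓝 p, x ∈ freeBoundary u ↔ h ⟪x, rot e⟫ = ⟪x, e⟫) ∧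
      ∃ δ > 0, ∀ s ∈ Metric.ball ⟪p, rot e⟫ δ,
        planePt e s (h s) ∈ connectedComponentIn (freeBoundary u) p := by
  obtain ⟨h, h', hC, hd, h0, hslope, hF, hev⟩ := hu.exists_graph hp he hpe
  refine ⟨h, h', hd, h0, hslope, hF, ?_⟩
  obtain ⟨K, t, ht, hK⟩ := hC.exists_lipschitzOnWith
  obtain ⟨δ, hδ, hball⟩ := Metric.mem_nhds_iff.1 (inter_mem ht hev)
  refine ⟨δ, hδ, ?_⟩
  have hcont : ContinuousOn (fun s => planePt e s (h s)) (Metric.ball ⟪p, rot e⟫ δ) := by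
    have h1 : ContinuousOn h (Metric.ball ⟪p, rot e⟫ δ) :=
      hK.continuousOn.mono fun s hs => (hball hs).1
    unfold planePt
    fun_prop
  have hpre := (convex_ball ⟪p, rot e⟫ δ).isPreconnected.image _ hcont
  have hsub := hpre.subset_connectedComponentIn (x := p) (F := freeBoundary u)
    ⟨⟪p, rot e⟫, Metric.mem_ball_self hδ, by simp only [h0, planePt_inner he]⟩ (by
      rintro _ ⟨s, hs, rfl⟩
      exact (hball hs).2)
  exact fun s hs => hsub ⟨s, hs, rfl⟩

/-- The components of the free boundary are relatively open. -/
lemma IsClassicalSolution.exists_nhds_subset_component (hu : IsClassicalSolution u)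
    {p : Plane} (hp : p ∈ freeBoundary u) :
    ∃ U ∈ 𝓝 p, freeBoundary u ∩ U ⊆ connectedComponentIn (freeBoundary u) p := by
  have he : ‖gradPos u p‖ = 1 := hu.norm_grad_eq_one p hp
  obtain ⟨h, h', -, -, -, hF, δ, hδ, hball⟩ := hu.exists_graph_subset_component hp he (by
    rw [real_inner_self_eq_norm_sq, he]; norm_num)
  have hcoord : Tendsto (fun x : Plane => ⟪x, rot (gradPos u p)⟫) (𝓝 p)
      (𝓝 ⟪p, rot (gradPos u p)⟫) := by
    have : Continuous fun x : Plane => ⟪x, rot (gradPos u p)⟫ := by fun_prop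
    exact this.tendsto p
  refine ⟨_, hF.and (hcoord.eventually (Metric.ball_mem_nhds _ hδ)), ?_⟩
  rintro x ⟨hxF, hx1, hx2⟩
  have := hball _ hx2
  rwa [hx1.1 hxF, planePt_inner he] at this

/-- The connected components of the free boundary, as subsets of the plane. -/
def boundaryComponents (u : Plane → ℝ) : Set (Set Plane) :=
  connectedComponentIn (freeBoundary u) '' freeBoundary u

lemma hasFiniteTopology_of_finite (h : (boundaryComponents u).Finite) : HasFiniteTopology u := by
  have hfin : Finite (boundaryComponents u) := h
  let f : freeBoundary u → boundaryComponents u := fun x => ⟨_, mem_image_of_mem _ x.2⟩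
  have hf : ∀ x y : freeBoundary u, f x = f y →
      (x : ConnectedComponents (freeBoundary u)) = y := by
    intro x y hxy
    have h1 : connectedComponentIn (freeBoundary u) x.1 =
        connectedComponentIn (freeBoundary u) y.1 := congrArg Subtype.val hxy
    rw [connectedComponentIn_eq_image x.2, connectedComponentIn_eq_image y.2] at h1
    exact ConnectedComponents.coe_eq_coe.2 (image_injective.2 Subtype.val_injective h1)
  refine Finite.of_injective
    (fun c : ConnectedComponents (freeBoundary u) => f (Quot.out c)) fun c d hcd => ?_
  have := hf _ _ hcd
  rwa [show ((Quot.out c : freeBoundary u) : ConnectedComponents (freeBoundary u)) = c from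
    Quot.out_eq c, show ((Quot.out d : freeBoundary u) : ConnectedComponents (freeBoundary u)) = d
    from Quot.out_eq d] at this

lemma isClosed_of_mem_boundaryComponents {C : Set Plane} (hC : C ∈ boundaryComponents u) :
    IsClosed C := by
  obtain ⟨x, hx, rfl⟩ := hC
  rw [connectedComponentIn_eq_image hx]
  exact isClosed_freeBoundary.isClosedEmbedding_subtypeVal.isClosedMap _
    isClosed_connectedComponent

lemma subset_of_mem_boundaryComponents {C : Set Plane} (hC : C ∈ boundaryComponents u) :
    C ⊆ freeBoundary u := by
  obtain ⟨x, hx, rfl⟩ := hC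
  exact connectedComponentIn_subset _ _

lemma eq_connectedComponentIn_of_mem {C : Set Plane} (hC : C ∈ boundaryComponents u) {p : Plane}
    (hp : p ∈ C) : C = connectedComponentIn (freeBoundary u) p := by
  obtain ⟨x, hx, rfl⟩ := hC
  exact connectedComponentIn_eq hp

/-- A compact set meets only finitely many components of the free boundary. -/
lemma IsClassicalSolution.finite_components_inter (hu : IsClassicalSolution u) {K : Set Plane}
    (hK : IsCompact K) : {C ∈ boundaryComponents u | (C ∩ K).Nonempty}.Finite := by
  have hc : IsCompact (freeBoundary u ∩ K) := hK.inter_left isClosed_freeBoundary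
  choose! U hU hUc using fun p hp => hu.exists_nhds_subset_component (u := u) (p := p) hp
  obtain ⟨t, ht, hcov⟩ := hc.elim_nhds_subcover U fun p hp => hU p hp.1
  refine (t.finite_toSet.image (connectedComponentIn (freeBoundary u))).subset ?_
  rintro C ⟨hC, x, hxC, hxK⟩
  have hxF := subset_of_mem_boundaryComponents hC hxC
  obtain ⟨p, hp, hxp⟩ := mem_iUnion₂.1 (hcov ⟨hxF, hxK⟩)
  refine ⟨p, hp, ?_⟩
  rw [eq_connectedComponentIn_of_mem hC hxC]
  exact connectedComponentIn_eq (hUc p (ht p hp).1 ⟨hxF, hxp⟩)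

/-- A component on which the normal stays close to `e` is a local graph over the line orthogonal
to `e`. -/
lemma IsClassicalSolution.isLocalGraph_component (hu : IsClassicalSolution u) {C : Set Plane}
    (hC : C ∈ boundaryComponents u) {e : Plane} (he : ‖e‖ = 1)
    (hCe : ∀ x ∈ C, 1 / 2 ≤ ⟪gradPos u x, e⟫) :
    IsLocalGraph {z : ℝ × ℝ | planePt e z.1 z.2 ∈ C} := by
  intro q hq
  set p := planePt e q.1 q.2 with hp
  have hpF := subset_of_mem_boundaryComponents hC hq
  have hpe := hCe p hq
  have hp1 : ⟪p, rot e⟫ = q.1 := inner_planePt_rot he _ _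
  have hp2 : ⟪p, e⟫ = q.2 := inner_planePt he _ _
  obtain ⟨h, h', hd, h0, hslope, hF, δ, hδ, hball⟩ :=
    hu.exists_graph_subset_component hpF he (by linarith)
  rw [← eq_connectedComponentIn_of_mem hC hq] at hball
  rw [hp1] at hd h0 hball
  rw [hp2] at h0
  -- The normal component along `e` is at least `1 / 2` and the one along `rot e` at most `1`, so
  -- the slope is at most `2`. The strict inequality with `3` leaves room for a Lipschitz bound
  -- nearby.
  have hh' : ‖ContinuousLinearMap.toSpanSingleton ℝ h'‖₊ < 3 := by
    rw [← NNReal.coe_lt_coe, coe_nnnorm, ContinuousLinearMap.norm_toSpanSingleton,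
      Real.norm_eq_abs]
    have h1 : |⟪gradPos u p, rot e⟫| ≤ 1 := by
      have := abs_real_inner_le_norm (gradPos u p) (rot e)
      rwa [norm_rot, he, hu.norm_grad_eq_one p hpF, mul_one] at this
    have h2 : |h'| * ⟪gradPos u p, e⟫ ≤ 1 := by
      rw [← abs_of_pos (show 0 < ⟪gradPos u p, e⟫ by linarith), ← abs_mul]
      rwa [show h' * ⟪gradPos u p, e⟫ = -⟪gradPos u p, rot e⟫ by linarith, abs_neg]
    have h3 := abs_nonneg h'
    push_cast
    nlinarith
  obtain ⟨t, ht, hl⟩ := hd.hasStrictFDerivAt.exists_lipschitzOnWith_of_nnnorm_lt 3 hh'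
  obtain ⟨δ', hδ', hball'⟩ := Metric.mem_nhds_iff.1 ht
  refine ⟨h, min δ δ', lt_min hδ hδ', hl.mono
    ((Metric.ball_subset_ball (min_le_right _ _)).trans hball'), h0,
    fun s hs => hball s (Metric.ball_subset_ball (min_le_left _ _) hs), ?_⟩
  have hpt : Tendsto (fun z : ℝ × ℝ => planePt e z.1 z.2) (𝓝 q) (𝓝 p) :=
    (continuous_planePt e).tendsto q
  filter_upwards [hpt.eventually hF] with z hz hzC
  have := hz.1 (subset_of_mem_boundaryComponents hC hzC)
  rwa [inner_planePt_rot he, inner_planePt he] at this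

/-- If the normal stays close to `e` on a component, the positive phase lies above an entire graph
contained in that component. -/
lemma IsClassicalSolution.exists_entire_graph (hu : IsClassicalSolution u)
    (hconn : IsConnected (posPhase u)) {C : Set Plane}
    (hC : C ∈ boundaryComponents u) {e : Plane} (he : ‖e‖ = 1)
    (hCe : ∀ x ∈ C, 1 / 2 ≤ ⟪gradPos u x, e⟫) :
    ∃ h : ℝ → ℝ, (∀ s, planePt e s (h s) ∈ C) ∧
      ∀ x ∈ closure (posPhase u), h ⟪x, rot e⟫ ≤ ⟪x, e⟫ := by
  obtain ⟨p, hpF, hpC⟩ := hC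
  have hC : C ∈ boundaryComponents u := ⟨p, hpF, hpC⟩
  have hp : p ∈ C := by rw [← hpC]; exact mem_connectedComponentIn hpF
  have hclosed : IsClosed {z : ℝ × ℝ | planePt e z.1 z.2 ∈ C} :=
    (isClosed_of_mem_boundaryComponents hC).preimage (continuous_planePt e)
  obtain ⟨h, hcont, h0, hg⟩ := (hu.isLocalGraph_component hC he hCe).exists_entire hclosed
    (q := (⟪p, rot e⟫, ⟪p, e⟫)) (by simpa [planePt_inner he] using hp)
  simp only at h0
  refine ⟨h, hg, ?_⟩
  have c1 : Continuous fun x : Plane => h ⟪x, rot e⟫ := by fun_prop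
  have c2 : Continuous fun x : Plane => ⟪x, e⟫ := by fun_prop
  -- The graph lies in `F(u)`, so the connected set `Ω` lies on one side of it; moving from `p` in
  -- direction `e` shows that it is the upper side.
  have hsub : posPhase u ⊆ {x | h ⟪x, rot e⟫ < ⟪x, e⟫} := by
    refine hconn.isPreconnected.subset_left_of_subset_union (isOpen_lt c1 c2) (isOpen_lt c2 c1)
      (disjoint_left.2 fun x (hx : h ⟪x, rot e⟫ < ⟪x, e⟫) hx' => hx.asymm hx') ?_ ?_
    · intro x hx
      rcases lt_trichotomy (h ⟪x, rot e⟫) ⟪x, e⟫ with h1 | h1 | h1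
      · exact Or.inl h1
      · have := subset_of_mem_boundaryComponents hC (hg ⟪x, rot e⟫)
        simp only [h1, planePt_inner he] at this
        exact absurd hx (hu.notMem_posPhase this)
      · exact Or.inr h1
    · have hev := hu.eventually_mem_posPhase (v := e) hpF (by linarith [hCe p hp])
      obtain ⟨t, ht, ht0⟩ := (hev.and self_mem_nhdsWithin).exists
      refine ⟨p + t • e, ht, ?_⟩
      have hee : ⟪e, e⟫ = 1 := by rw [real_inner_self_eq_norm_sq, he, one_pow]
      have her : ⟪e, rot e⟫ = 0 := by rw [real_inner_comm, inner_rot_self]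
      simp only [mem_ofPred_eq, inner_add_left, inner_smul_left, hee, her]
      simp only [mul_zero, add_zero, h0]
      simpa using ht0
  intro x hx
  exact closure_minimal (hsub.trans fun y hy => le_of_lt hy) (isClosed_le c1 c2) hx

/-- Each of the two entire graphs lies in the closure of `Ω`, hence above the other. They therefore
meet over `0`, and components with a common point are equal. -/
lemma IsClassicalSolution.component_unique (hu : IsClassicalSolution u)
    (hconn : IsConnected (posPhase u)) {C C' : Set Plane}
    (hC : C ∈ boundaryComponents u) (hC' : C' ∈ boundaryComponents u) {e : Plane} (he : ‖e‖ = 1)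
    (hCe : ∀ x ∈ C, 1 / 2 ≤ ⟪gradPos u x, e⟫) (hCe' : ∀ x ∈ C', 1 / 2 ≤ ⟪gradPos u x, e⟫) :
    C = C' := by
  obtain ⟨h, hg, hD⟩ := hu.exists_entire_graph hconn hC he hCe
  obtain ⟨k, kg, kD⟩ := hu.exists_entire_graph hconn hC' he hCe'
  have h1 := hD _ (freeBoundary_subset_closure (subset_of_mem_boundaryComponents hC' (kg 0)))
  have h2 := kD _ (freeBoundary_subset_closure (subset_of_mem_boundaryComponents hC (hg 0)))
  simp only [inner_planePt_rot he, inner_planePt he] at h1 h2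
  have hx := hg 0
  rw [le_antisymm h1 h2] at hx
  rw [eq_connectedComponentIn_of_mem hC hx, eq_connectedComponentIn_of_mem hC' (kg 0)]

/-- The four coordinate directions. -/
def axisDir : Fin 2 × Bool → Plane := fun i =>
  (if i.2 then 1 else -1 : ℝ) • EuclideanSpace.single i.1 1

lemma norm_axisDir (i : Fin 2 × Bool) : ‖axisDir i‖ = 1 := by
  rcases i with ⟨i, _ | _⟩ <;> simp [axisDir]

/-- Some coordinate has modulus at least `1 / √2 > 5 / 8`. The value `5 / 8 = 1 / 2 + 1 / 8` leaves
`1 / 2` after the normal has turned by `1 / 8`. -/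
lemma exists_axisDir {w : Plane} (hw : ‖w‖ = 1) : ∃ i, 5 / 8 ≤ ⟪w, axisDir i⟫ := by
  have h := coord_sq_of_norm_one hw
  have hin : ∀ i : Fin 2, ⟪w, (EuclideanSpace.single i 1 : Plane)⟫ = w i := fun i => by
    simp [EuclideanSpace.inner_single_right]
  by_contra! hcon
  have h1 := hcon (0, true)
  have h2 := hcon (0, false)
  have h3 := hcon (1, true)
  have h4 := hcon (1, false)
  simp only [axisDir, inner_smul_right, hin, if_true, Bool.false_eq_true, if_false] at h1 h2 h3 h4
  have h5 : w 0 ^ 2 < 1 / 2 := by nlinarith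
  have h6 : w 1 ^ 2 < 1 / 2 := by nlinarith
  linarith

/-- All but finitely many components of the free boundary have total curvature at least `1 / 8`. -/
theorem IsClassicalSolution.finite_flat_components (hu : IsClassicalSolution u)
    (hconn : IsConnected (posPhase u)) :
    {C ∈ boundaryComponents u | ∫⁻ x in C, ENNReal.ofReal (meanCurvature u x)
      ∂(Measure.hausdorffMeasure 1) < ENNReal.ofReal (1 / 8)}.Finite := by
  have key : ∀ C ∈ {C ∈ boundaryComponents u | ∫⁻ x in C, ENNReal.ofReal (meanCurvature u x)
      ∂(Measure.hausdorffMeasure 1) < ENNReal.ofReal (1 / 8)},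
      ∃ i, ∀ x ∈ C, 1 / 2 ≤ ⟪gradPos u x, axisDir i⟫ := by
    rintro C ⟨hC, hlt⟩
    obtain ⟨p, hpF, hpC⟩ := id hC
    have hp : p ∈ C := by rw [← hpC]; exact mem_connectedComponentIn hpF
    have hpre : IsPreconnected C := by rw [← hpC]; exact isPreconnected_connectedComponentIn
    obtain ⟨i, hi⟩ := exists_axisDir (hu.norm_grad_eq_one p hpF)
    refine ⟨i, fun x hx => ?_⟩
    have hCF := subset_of_mem_boundaryComponents hC
    have h1 := (hu.edist_innerNormal_le hCF hpre
      (isClosed_of_mem_boundaryComponents hC).measurableSet hp hx).trans_lt hlt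
    rw [edist_dist, ENNReal.ofReal_lt_ofReal_iff (by norm_num), dist_eq_norm,
      hu.innerNormal_eq hpF, hu.innerNormal_eq (hCF hx)] at h1
    have h2 := real_inner_le_norm (gradPos u p - gradPos u x) (axisDir i)
    rw [norm_axisDir, mul_one, inner_sub_left] at h2
    linarith
  choose! f hf using key
  -- Each of the four directions is taken by at most one flat component.
  refine Finite.of_injOn (f := f) (t := univ) (fun _ _ => mem_univ _) ?_ finite_univ
  intro C hC C' hC' hff
  exact hu.component_unique hconn hC.1 hC'.1 (norm_axisDir (f C)) (hf C hC)
    (by rw [hff]; exact hf C' hC')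

/-- If the free boundary has infinitely many components, it carries a fixed amount of curvature
outside of any ball. -/
theorem IsClassicalSolution.le_lintegral_compl_ball (hu : IsClassicalSolution u)
    (hconn : IsConnected (posPhase u)) (hinf : (boundaryComponents u).Infinite) (R : ℝ) :
    ENNReal.ofReal (1 / 8) ≤ ∫⁻ x in freeBoundary u \ Metric.closedBall 0 R,
      ENNReal.ofReal (meanCurvature u x) ∂(Measure.hausdorffMeasure 1) := by
  -- Outside these two finite families there is still a component: it avoids the ball and carries
  -- curvature at least `1 / 8` by itself.
  have h1 := (hu.finite_components_inter (isCompact_closedBall (0 : Plane) R)).union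
    (hu.finite_flat_components hconn)
  obtain ⟨C, hC, hCn⟩ := hinf.exists_notMem_finite h1
  simp only [mem_union, mem_ofPred_eq, not_or, not_and] at hCn
  have h2 := not_nonempty_iff_eq_empty.1 (hCn.1 hC)
  refine (not_lt.1 (hCn.2 hC)).trans (lintegral_mono_set fun x hx => ?_)
  exact ⟨subset_of_mem_boundaryComponents hC hx, fun hxR => by
    have : x ∈ C ∩ Metric.closedBall 0 R := ⟨hx, hxR⟩
    rw [h2] at this
    exact this⟩

end Components

/-! ### Logarithmic cutoffs -/

section Cutoff

/-- A smooth function of logarithmic growth. -/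
def logNorm (x : Plane) : ℝ := Real.log (1 + ‖x‖ ^ 2)

lemma one_add_norm_sq_pos (x : Plane) : 0 < 1 + ‖x‖ ^ 2 := by positivity

lemma contDiff_logNorm : ContDiff ℝ ∞ logNorm :=
  (contDiff_const.add (contDiff_norm_sq ℝ)).log fun x => (one_add_norm_sq_pos x).ne'

lemma hasFDerivAt_logNorm (x : Plane) :
    HasFDerivAt logNorm ((1 + ‖x‖ ^ 2)⁻¹ • (2 • innerSL ℝ x)) x :=
  ((hasStrictFDerivAt_norm_sq x).hasFDerivAt.const_add 1).log (one_add_norm_sq_pos x).ne'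

/-- The radius at which `logNorm` takes the value `a`. -/
def logRadius (a : ℝ) : ℝ := √(Real.exp a - 1)

lemma logNorm_le_iff {a : ℝ} (ha : 0 ≤ a) (x : Plane) : logNorm x ≤ a ↔ ‖x‖ ≤ logRadius a := by
  rw [logNorm, Real.log_le_iff_le_exp (one_add_norm_sq_pos x), logRadius,
    Real.le_sqrt (norm_nonneg _)]
  · constructor <;> intro h <;> linarith
  · linarith [Real.one_le_exp ha]

lemma le_logNorm_iff {a : ℝ} (x : Plane) : a ≤ logNorm x ↔ logRadius a ≤ ‖x‖ := by
  rw [logNorm, Real.le_log_iff_exp_le (one_add_norm_sq_pos x), logRadius,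
    Real.sqrt_le_left (norm_nonneg _)]
  constructor <;> intro h <;> linarith

/-- A smooth function that passes from `0` to `1` on the annulus `a ≤ logNorm ≤ a + L`. -/
def logStep (a L : ℝ) (x : Plane) : ℝ := Real.smoothTransition ((logNorm x - a) / L)

lemma contDiff_logStep (a L : ℝ) : ContDiff ℝ ∞ (logStep a L) :=
  Real.smoothTransition.contDiff.comp ((contDiff_logNorm.sub contDiff_const).div_const L)

lemma logStep_eq_zero {a L : ℝ} (hL : 0 < L) {x : Plane} (h : logNorm x ≤ a) :
    logStep a L x = 0 :=
  Real.smoothTransition.zero_of_nonpos (div_nonpos_of_nonpos_of_nonneg (by linarith) hL.le)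

lemma logStep_eq_one {a L : ℝ} (hL : 0 < L) {x : Plane} (h : a + L ≤ logNorm x) :
    logStep a L x = 1 :=
  Real.smoothTransition.one_of_one_le ((one_le_div hL).2 (by linarith))

lemma deriv_smoothTransition_eq_zero {t : ℝ} (ht : t ∉ Icc (0 : ℝ) 1) :
    deriv Real.smoothTransition t = 0 := by
  rw [mem_Icc, not_and_or, not_le, not_le] at ht
  rcases ht with ht | ht
  · have : Real.smoothTransition =ᶠ[𝓝 t] fun _ => 0 := by
      filter_upwards [Iio_mem_nhds ht] with s hs
        using Real.smoothTransition.zero_of_nonpos (le_of_lt hs)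
    rw [this.deriv_eq, deriv_const]
  · have : Real.smoothTransition =ᶠ[𝓝 t] fun _ => 1 := by
      filter_upwards [Ioi_mem_nhds ht] with s hs
        using Real.smoothTransition.one_of_one_le (le_of_lt hs)
    rw [this.deriv_eq, deriv_const]

lemma exists_bound_deriv_smoothTransition :
    ∃ C : ℝ, 0 ≤ C ∧ ∀ t, |deriv Real.smoothTransition t| ≤ C := by
  have hc : Continuous (deriv Real.smoothTransition) :=
    (Real.smoothTransition.contDiff (n := 1)).continuous_deriv (by simp)
  obtain ⟨C, hC⟩ := isCompact_Icc.exists_bound_of_continuousOn (s := Icc (0 : ℝ) 1)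
    hc.continuousOn
  refine ⟨C, (norm_nonneg _).trans (hC 0 ⟨le_rfl, zero_le_one⟩), fun t => ?_⟩
  by_cases ht : t ∈ Icc (0 : ℝ) 1
  · exact hC t ht
  · rw [deriv_smoothTransition_eq_zero ht, abs_zero]
    exact (norm_nonneg _).trans (hC 0 ⟨le_rfl, zero_le_one⟩)

/-- The radial majorant of the Dirichlet density of a logarithmic cutoff. -/
def radialBound (C a L : ℝ) : ℝ → ℝ :=
  (Icc (logRadius a) (logRadius (a + L))).indicator
    fun r => (C / L) ^ 2 * (2 * r / (1 + r ^ 2)) ^ 2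

/-- Chain rule: the transition contributes `C / L`, the logarithm contributes `2r / (1 + r²)`, and
the gradient vanishes off the annulus. -/
lemma norm_gradient_logStep_sq_le {C : ℝ} (hC : ∀ t, |deriv Real.smoothTransition t| ≤ C)
    {a L : ℝ} (ha : 0 ≤ a) (hL : 0 < L) (x : Plane) :
    ‖gradient (logStep a L) x‖ ^ 2 ≤ radialBound C a L ‖x‖ := by
  have hd : HasFDerivAt (logStep a L)
      (deriv Real.smoothTransition ((logNorm x - a) / L) •
        (L⁻¹ • ((1 + ‖x‖ ^ 2)⁻¹ • (2 • innerSL ℝ x)))) x := by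
    have h1 : HasDerivAt Real.smoothTransition
        (deriv Real.smoothTransition ((logNorm x - a) / L)) ((logNorm x - a) / L) :=
      ((Real.smoothTransition.contDiff (n := 1)).differentiable (by simp) _).hasDerivAt
    have h2 : HasFDerivAt (fun x => (logNorm x - a) / L)
        (L⁻¹ • ((1 + ‖x‖ ^ 2)⁻¹ • (2 • innerSL ℝ x))) x := by
      simp only [div_eq_inv_mul]
      exact ((hasFDerivAt_logNorm x).sub_const a).const_smul L⁻¹
    exact h1.comp_hasFDerivAt x h2
  have hnorm : ‖gradient (logStep a L) x‖ =
      |deriv Real.smoothTransition ((logNorm x - a) / L)| / L * (2 * ‖x‖ / (1 + ‖x‖ ^ 2)) := by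
    rw [gradient, LinearIsometryEquiv.norm_map, hd.fderiv, norm_smul, norm_smul, norm_smul,
      Real.norm_eq_abs, norm_inv, norm_inv, Real.norm_of_nonneg hL.le,
      Real.norm_of_nonneg (one_add_norm_sq_pos x).le, ← Nat.cast_smul_eq_nsmul ℝ, norm_smul,
      innerSL_apply_norm]
    simp
    field_simp
  by_cases hx : ‖x‖ ∈ Icc (logRadius a) (logRadius (a + L))
  · rw [radialBound, indicator_of_mem hx, hnorm, mul_pow]
    have := hC ((logNorm x - a) / L)
    gcongr
  · rw [radialBound, indicator_of_notMem hx, hnorm]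
    have : (logNorm x - a) / L ∉ Icc (0 : ℝ) 1 := by
      intro h
      have h1 : a ≤ logNorm x := by
        have h0 := mul_nonneg h.1 hL.le
        rw [div_mul_cancel₀ _ hL.ne'] at h0
        linarith
      have h2 : logNorm x ≤ a + L := by
        have := (div_le_one hL).1 h.2
        linarith
      exact hx ⟨(le_logNorm_iff x).1 h1, (logNorm_le_iff (by linarith) x).1 h2⟩
    rw [deriv_smoothTransition_eq_zero this]
    simp

lemma logRadius_nonneg (a : ℝ) : 0 ≤ logRadius a := Real.sqrt_nonneg _

lemma log_one_add_logRadius_sq {a : ℝ} (ha : 0 ≤ a) : Real.log (1 + logRadius a ^ 2) = a := by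
  rw [logRadius, Real.sq_sqrt (by linarith [Real.one_le_exp ha])]
  simp

lemma integral_log_density {a L : ℝ} (ha : 0 ≤ a) (hL : 0 ≤ L) :
    ∫ y in Icc (logRadius a) (logRadius (a + L)), 2 * y / (1 + y ^ 2) = L := by
  have hle : logRadius a ≤ logRadius (a + L) :=
    Real.sqrt_le_sqrt (by linarith [Real.exp_le_exp.2 (show a ≤ a + L by linarith)])
  rw [integral_Icc_eq_integral_Ioc, ← intervalIntegral.integral_of_le hle]
  have hd : ∀ y ∈ uIcc (logRadius a) (logRadius (a + L)),
      HasDerivAt (fun y : ℝ => Real.log (1 + y ^ 2)) (2 * y / (1 + y ^ 2)) y := by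
    intro y _
    have := ((hasDerivAt_pow 2 y).const_add 1).log (by positivity)
    simpa using this
  rw [intervalIntegral.integral_eq_sub_of_hasDerivAt hd, log_one_add_logRadius_sq ha,
    log_one_add_logRadius_sq (by linarith)]
  · ring
  · refine ContinuousOn.intervalIntegrable ?_
    exact (by fun_prop : Continuous fun y : ℝ => 2 * y).continuousOn.div
      (by fun_prop) fun y _ => by positivity

lemma integrableOn_log_density (α β : ℝ) :
    IntegrableOn (fun y : ℝ => 2 * y / (1 + y ^ 2)) (Icc α β) := by
  refine ContinuousOn.integrableOn_Icc ?_
  exact (by fun_prop : Continuous fun y : ℝ => 2 * y).continuousOn.div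
    (by fun_prop) fun y _ => by positivity

lemma integrable_radialBound (C a L : ℝ) : Integrable fun x : Plane => radialBound C a L ‖x‖ := by
  have hcont : Continuous fun x : Plane => (C / L) ^ 2 * (2 * ‖x‖ / (1 + ‖x‖ ^ 2)) ^ 2 :=
    continuous_const.mul (((by fun_prop : Continuous fun x : Plane => 2 * ‖x‖).div
      (by fun_prop) fun x => (one_add_norm_sq_pos x).ne').pow 2)
  have hm : MeasurableSet {x : Plane | ‖x‖ ∈ Icc (logRadius a) (logRadius (a + L))} :=
    (isClosed_Icc.preimage continuous_norm).measurableSet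
  have heq : (fun x : Plane => radialBound C a L ‖x‖) =
      {x : Plane | ‖x‖ ∈ Icc (logRadius a) (logRadius (a + L))}.indicator
        fun x => (C / L) ^ 2 * (2 * ‖x‖ / (1 + ‖x‖ ^ 2)) ^ 2 := by
    ext x
    by_cases hx : ‖x‖ ∈ Icc (logRadius a) (logRadius (a + L))
    · rw [radialBound, indicator_of_mem hx, indicator_of_mem (by exact hx)]
    · rw [radialBound, indicator_of_notMem hx, indicator_of_notMem (by exact hx)]
  rw [heq, integrable_indicator_iff hm]
  refine (hcont.continuousOn.integrableOn_compact
    (isCompact_closedBall (0 : Plane) (logRadius (a + L)))).mono_set fun x hx => ?_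
  rw [mem_closedBall_zero_iff]
  exact hx.2

/-- The measure of the unit disk. -/
def diskArea : ℝ := (volume : Measure Plane).real (Metric.ball 0 1)

/-- In polar coordinates the area factor `y` cancels one power of the density, as `y * (2 * y / (1 +
y ^ 2)) ≤ 2`. The remaining density is the derivative of `log (1 + y ^ 2)` and integrates to `L`, so
`(C / L) ^ 2` becomes a multiple of `1 / L`, independent of `a`. -/
lemma integral_radialBound_le {C a L : ℝ} (ha : 0 ≤ a) (hL : 0 < L) :
    ∫ x : Plane, radialBound C a L ‖x‖ ≤ 4 * C ^ 2 * diskArea / L := by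
  have hdisk : 0 ≤ diskArea := measureReal_nonneg
  rw [integral_fun_norm_addHaar volume (radialBound C a L)]
  have hdim : Module.finrank ℝ Plane = 2 := by simp
  rw [hdim]
  have hintgr : ∫ y in Ioi (0 : ℝ), y ^ (2 - 1) • radialBound C a L y ≤ 2 * C ^ 2 / L := by
    have hle : ∀ y ∈ Ioi (0 : ℝ), y ^ (2 - 1) • radialBound C a L y ≤
        (Icc (logRadius a) (logRadius (a + L))).indicator
          (fun y => 2 * (C / L) ^ 2 * (2 * y / (1 + y ^ 2))) y := by
      intro y hy
      have hy0 : (0 : ℝ) < y := hy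
      by_cases h : y ∈ Icc (logRadius a) (logRadius (a + L))
      · rw [radialBound, indicator_of_mem h, indicator_of_mem h]
        have h1 : y * (2 * y / (1 + y ^ 2)) ≤ 2 := by
          rw [← mul_div_assoc, div_le_iff₀ (by positivity)]
          nlinarith
        have h2 : 0 ≤ (C / L) ^ 2 * (2 * y / (1 + y ^ 2)) := by positivity
        simp only [smul_eq_mul]
        calc y ^ (2 - 1) * ((C / L) ^ 2 * (2 * y / (1 + y ^ 2)) ^ 2)
            = (C / L) ^ 2 * (2 * y / (1 + y ^ 2)) * (y * (2 * y / (1 + y ^ 2))) := by ring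
          _ ≤ (C / L) ^ 2 * (2 * y / (1 + y ^ 2)) * 2 := by gcongr
          _ = _ := by ring
      · simp [radialBound, indicator_of_notMem h]
    have hI : Integrable ((Icc (logRadius a) (logRadius (a + L))).indicator
        (fun y : ℝ => 2 * (C / L) ^ 2 * (2 * y / (1 + y ^ 2)))) := by
      rw [integrable_indicator_iff measurableSet_Icc]
      exact (integrableOn_log_density _ _).const_mul _
    have hnn : ∀ y ∈ Ioi (0 : ℝ), 0 ≤ y ^ (2 - 1) • radialBound C a L y := by
      intro y hy
      refine mul_nonneg (pow_nonneg (le_of_lt hy) _) ?_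
      exact indicator_nonneg (fun r _ => by positivity) y
    have hnn' : ∀ y, 0 ≤ (Icc (logRadius a) (logRadius (a + L))).indicator
        (fun y : ℝ => 2 * (C / L) ^ 2 * (2 * y / (1 + y ^ 2))) y := fun y =>
      indicator_nonneg (fun r hr => by
        have : 0 ≤ r := (logRadius_nonneg a).trans hr.1
        positivity) y
    calc ∫ y in Ioi (0 : ℝ), y ^ (2 - 1) • radialBound C a L y
        ≤ ∫ y in Ioi (0 : ℝ), (Icc (logRadius a) (logRadius (a + L))).indicator
          (fun y => 2 * (C / L) ^ 2 * (2 * y / (1 + y ^ 2))) y := by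
          refine integral_mono_of_nonneg ?_ hI.integrableOn ?_
          · exact (ae_restrict_iff' measurableSet_Ioi).2 (Eventually.of_forall hnn)
          · exact (ae_restrict_iff' measurableSet_Ioi).2 (Eventually.of_forall hle)
      _ ≤ ∫ y, (Icc (logRadius a) (logRadius (a + L))).indicator
          (fun y : ℝ => 2 * (C / L) ^ 2 * (2 * y / (1 + y ^ 2))) y :=
          setIntegral_le_integral hI (Eventually.of_forall hnn')
      _ = 2 * C ^ 2 / L := by
          rw [integral_indicator measurableSet_Icc, integral_const_mul,
            integral_log_density ha hL.le]
          field_simp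
  rw [nsmul_eq_mul, smul_eq_mul]
  calc ((2 : ℕ) : ℝ) * ((volume : Measure Plane).real (Metric.ball 0 1) *
        ∫ y in Ioi (0 : ℝ), y ^ (2 - 1) • radialBound C a L y)
      ≤ ((2 : ℕ) : ℝ) * (diskArea * (2 * C ^ 2 / L)) := by
        unfold diskArea at hdisk ⊢
        gcongr
    _ = _ := by push_cast; ring

/-- The logarithmic cutoff that is `1` on the annulus `a + L ≤ logNorm ≤ b`. -/
def logCutoff (L a b : ℝ) (x : Plane) : ℝ := logStep a L x - logStep b L x

lemma contDiff_logCutoff (L a b : ℝ) : ContDiff ℝ ∞ (logCutoff L a b) :=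
  (contDiff_logStep a L).sub (contDiff_logStep b L)

lemma logCutoff_eq_zero {L a b : ℝ} (hL : 0 < L) (hab : a + L ≤ b) {x : Plane}
    (hx : logNorm x ∉ Icc a (b + L)) : logCutoff L a b x = 0 := by
  rw [mem_Icc, not_and_or, not_le, not_le] at hx
  rcases hx with hx | hx
  · rw [logCutoff, logStep_eq_zero hL hx.le, logStep_eq_zero hL (by linarith), sub_zero]
  · rw [logCutoff, logStep_eq_one hL (by linarith), logStep_eq_one hL hx.le, sub_self]

lemma logCutoff_eq_one {L a b : ℝ} (hL : 0 < L) {x : Plane}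
    (hx : logNorm x ∈ Icc (a + L) b) : logCutoff L a b x = 1 := by
  rw [logCutoff, logStep_eq_one hL hx.1, logStep_eq_zero hL hx.2, sub_zero]

lemma hasCompactSupport_logCutoff {L a b : ℝ} (hL : 0 < L) (ha : 0 ≤ a) (hab : a + L ≤ b) :
    HasCompactSupport (logCutoff L a b) := by
  refine HasCompactSupport.intro (isCompact_closedBall (0 : Plane) (logRadius (b + L)))
    fun x hx => logCutoff_eq_zero hL hab fun h => hx ?_
  rw [mem_closedBall_zero_iff]
  exact (logNorm_le_iff (by linarith) x).1 h.2

lemma continuous_gradient {f : Plane → ℝ} (hf : ContDiff ℝ ∞ f) : Continuous (gradient f) :=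
  (InnerProductSpace.toDual ℝ Plane).symm.continuous.comp (hf.continuous_fderiv (by simp))

lemma gradient_sub' {f g : Plane → ℝ} {x : Plane} (hf : DifferentiableAt ℝ f x)
    (hg : DifferentiableAt ℝ g x) :
    gradient (fun x => f x - g x) x = gradient f x - gradient g x := by
  simp only [gradient]
  rw [fderiv_fun_sub hf hg, map_sub]

/-- Logarithmic cutoffs have arbitrarily small Dirichlet energy. -/
lemma exists_energy_bound : ∃ K : ℝ, ∀ L a b : ℝ, 0 < L → 0 ≤ a → a + L ≤ b →
    ∫ x : Plane, ‖gradient (logCutoff L a b) x‖ ^ 2 ≤ K / L := by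
  obtain ⟨C, -, hC⟩ := exists_bound_deriv_smoothTransition
  refine ⟨16 * C ^ 2 * diskArea, fun L a b hL ha hab => ?_⟩
  have hb : 0 ≤ b := by linarith
  have hle : ∀ x : Plane, ‖gradient (logCutoff L a b) x‖ ^ 2 ≤
      2 * radialBound C a L ‖x‖ + 2 * radialBound C b L ‖x‖ := by
    intro x
    have h1 := norm_gradient_logStep_sq_le hC ha hL x
    have h2 := norm_gradient_logStep_sq_le hC hb hL x
    have h3 : gradient (logCutoff L a b) x = gradient (logStep a L) x - gradient (logStep b L) x :=
      gradient_sub' ((contDiff_logStep a L).differentiable (by simp) x)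
        ((contDiff_logStep b L).differentiable (by simp) x)
    have h4 := norm_sub_le (gradient (logStep a L) x) (gradient (logStep b L) x)
    rw [h3]
    have h5 := pow_le_pow_left₀ (norm_nonneg _) h4 2
    nlinarith [sq_nonneg (‖gradient (logStep a L) x‖ - ‖gradient (logStep b L) x‖)]
  have ia := (integrable_radialBound C a L).const_mul 2
  have ib := (integrable_radialBound C b L).const_mul 2
  calc ∫ x : Plane, ‖gradient (logCutoff L a b) x‖ ^ 2
      ≤ ∫ x : Plane, (2 * radialBound C a L ‖x‖ + 2 * radialBound C b L ‖x‖) :=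
        integral_mono_of_nonneg (Eventually.of_forall fun x => by positivity) (ia.add ib)
          (Eventually.of_forall hle)
    _ = 2 * (∫ x : Plane, radialBound C a L ‖x‖) +
          2 * ∫ x : Plane, radialBound C b L ‖x‖ := by
        rw [integral_add ia ib, integral_const_mul, integral_const_mul]
    _ ≤ 2 * (4 * C ^ 2 * diskArea / L) + 2 * (4 * C ^ 2 * diskArea / L) := by
        have h1 := integral_radialBound_le (C := C) ha hL
        have h2 := integral_radialBound_le (C := C) hb hL
        gcongr
    _ = _ := by ring

end Cutoff

/-! ### The Morse index -/

section Index

variable {u : Plane → ℝ}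

lemma secondVariation_zero : secondVariation u 0 0 = 0 := by
  have : gradient (0 : Plane → ℝ) = 0 := by
    ext1 x
    simp [gradient]
  simp [secondVariation, this]

/-- An infinite family of test functions that diagonalizes the second variation with negative
entries forces the index to be infinite. -/
lemma morseIndex_eq_top_of_diagonal {φ : ℕ → Plane → ℝ} (hφ : ∀ i, φ i ∈ testSpace u)
    (hneg : ∀ i, secondVariation u (φ i) (φ i) < 0)
    (hdiag : ∀ (s : Finset ℕ) (c : ℕ → ℝ), secondVariation u (∑ i ∈ s, c i • φ i)
      (∑ i ∈ s, c i • φ i) = ∑ i ∈ s, c i ^ 2 * secondVariation u (φ i) (φ i)) :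
    morseIndex u = ⊤ := by
  have hterm : ∀ (c : ℕ → ℝ) i, c i ^ 2 * secondVariation u (φ i) (φ i) ≤ 0 := fun c i =>
    mul_nonpos_of_nonneg_of_nonpos (sq_nonneg _) (hneg i).le
  have hstrict : ∀ (s : Finset ℕ) (c : ℕ → ℝ) i, i ∈ s → c i ≠ 0 →
      secondVariation u (∑ i ∈ s, c i • φ i) (∑ i ∈ s, c i • φ i) < 0 := by
    intro s c i hi hci
    rw [hdiag]
    refine Finset.sum_neg' (fun j _ => hterm c j) ⟨i, hi, ?_⟩
    exact mul_neg_of_pos_of_neg (by positivity) (hneg i)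
  have hli : LinearIndependent ℝ φ := by
    rw [linearIndependent_iff']
    intro s c hsum i hi
    by_contra hci
    have := hstrict s c i hi hci
    rw [hsum, secondVariation_zero] at this
    exact lt_irrefl _ this
  set V := Submodule.span ℝ (range φ) with hV
  have hVle : V ≤ testSpace u := Submodule.span_le.2 (by rintro _ ⟨i, rfl⟩; exact hφ i)
  have hVneg : IsNegDefOn u V := by
    intro ψ hψ hψ0
    obtain ⟨c, rfl⟩ := (Finsupp.mem_span_range_iff_exists_finsupp).1 hψ
    have hne : c.support.Nonempty := by
      rw [Finset.nonempty_iff_ne_empty]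
      intro h
      exact hψ0 (by simp [Finsupp.sum, h])
    obtain ⟨i, hi⟩ := hne
    exact hstrict c.support c i hi (Finsupp.mem_support_iff.1 hi)
  -- The single space `V` is already infinite-dimensional, so no exhaustion by finite-dimensional
  -- subspaces is needed.
  have hrank : Cardinal.toENat (Module.rank ℝ V) = ⊤ := by
    rw [Cardinal.toENat_eq_top, hV, rank_span hli, Cardinal.mk_range_eq _ hli.injective]
    simp
  rw [eq_top_iff, ← hrank]
  exact le_iSup_of_le V (le_iSup_of_le hVle (le_iSup_of_le hVneg le_rfl))

/-- Pythagoras for finitely many pairwise orthogonal vectors. -/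
lemma inner_sum_sum_of_orthogonal {E : Type*} [NormedAddCommGroup E] [InnerProductSpace ℝ E]
    (s : Finset ℕ) (c : ℕ → ℝ) (v : ℕ → E) (h : ∀ i j, i ≠ j → ⟪v i, v j⟫ = 0) :
    ⟪∑ i ∈ s, c i • v i, ∑ i ∈ s, c i • v i⟫ = ∑ i ∈ s, c i ^ 2 * ⟪v i, v i⟫ := by
  rw [sum_inner]
  refine Finset.sum_congr rfl fun i hi => ?_
  rw [inner_sum, Finset.sum_eq_single i]
  · rw [real_inner_smul_left, real_inner_smul_right]; ring
  · intro j _ hji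
    rw [real_inner_smul_left, real_inner_smul_right, h i j hji.symm]; ring
  · exact fun h => absurd hi h

/-- Restriction of a function on the plane to the closure of the positive phase. -/
def restrictPhase (u η : Plane → ℝ) : Plane → ℝ := (closure (posPhase u)).indicator η

lemma restrictPhase_of_mem {η : Plane → ℝ} {x : Plane} (hx : x ∈ closure (posPhase u)) :
    restrictPhase u η x = η x := indicator_of_mem hx _

lemma restrictPhase_mem_testSpace {η : Plane → ℝ} (hη : ContDiff ℝ ∞ η)
    (hc : HasCompactSupport η) : restrictPhase u η ∈ testSpace u := by
  refine ⟨hη.contDiffOn.congr fun x hx => restrictPhase_of_mem hx, ?_,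
    fun x hx => indicator_of_notMem hx _⟩
  exact hc.mono (support_indicator.trans_subset inter_subset_right)

lemma IsClassicalSolution.restrictPhase_eventuallyEq (hu : IsClassicalSolution u) (η : Plane → ℝ)
    {x : Plane} (hx : x ∈ posPhase u) : restrictPhase u η =ᶠ[𝓝 x] η := by
  filter_upwards [hu.isOpen_posPhase.mem_nhds hx] with y hy
    using restrictPhase_of_mem (subset_closure hy)

lemma IsClassicalSolution.gradient_restrictPhase (hu : IsClassicalSolution u) (η : Plane → ℝ)
    {x : Plane} (hx : x ∈ posPhase u) : gradient (restrictPhase u η) x = gradient η x := by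
  rw [gradient, gradient, (hu.restrictPhase_eventuallyEq η hx).fderiv_eq]

lemma gradient_sum_smul (s : Finset ℕ) (c : ℕ → ℝ) {φ : ℕ → Plane → ℝ} {x : Plane}
    (h : ∀ i, DifferentiableAt ℝ (φ i) x) :
    gradient (∑ i ∈ s, c i • φ i) x = ∑ i ∈ s, c i • gradient (φ i) x := by
  have hd : fderiv ℝ (∑ i ∈ s, c i • φ i) x = ∑ i ∈ s, c i • fderiv ℝ (φ i) x :=
    (HasFDerivAt.sum fun i _ => (h i).hasFDerivAt.const_smul (c i)).fderiv
  simp only [gradient]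
  rw [hd, map_sum]
  refine Finset.sum_congr rfl fun i _ => ?_
  rw [LinearIsometryEquiv.map_smulₛₗ]
  simp

lemma gradient_eq_zero_of_notMem {η : Plane → ℝ} {A : Set Plane} (hA : IsClosed A)
    (hη : ∀ x, x ∉ A → η x = 0) {x : Plane} (hx : x ∉ A) : gradient η x = 0 := by
  have : η =ᶠ[𝓝 x] fun _ => 0 := by
    filter_upwards [hA.isOpen_compl.mem_nhds hx] with y hy using hη y hy
  rw [gradient, this.fderiv_eq]
  simp

lemma integrable_norm_gradient_sq {η : Plane → ℝ} (hη : ContDiff ℝ ∞ η)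
    (hc : HasCompactSupport η) : Integrable fun x => ‖gradient η x‖ ^ 2 := by
  have hcont : Continuous fun x => ‖gradient η x‖ ^ 2 := (continuous_gradient hη).norm.pow 2
  refine hcont.integrable_of_hasCompactSupport ?_
  refine HasCompactSupport.intro hc fun x hx => ?_
  rw [gradient_eq_zero_of_notMem (isClosed_tsupport η) (fun y => image_eq_zero_of_notMem_tsupport)
    hx]
  simp

/-- The length measure of the free boundary is finite on compact sets. -/
lemma IsClassicalSolution.isFiniteMeasureOnCompacts (hu : IsClassicalSolution u) :
    IsFiniteMeasureOnCompacts
      ((Measure.hausdorffMeasure 1 : Measure Plane).restrict (freeBoundary u)) := by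
  refine ⟨fun K hK => ?_⟩
  rw [Measure.restrict_apply hK.measurableSet, inter_comm]
  exact hu.hausdorffMeasure_inter_compact_lt_top hK

lemma IsClassicalSolution.integrableOn_curvature_mul (hu : IsClassicalSolution u)
    {η : Plane → ℝ} (hη : Continuous η) (hc : HasCompactSupport η) :
    IntegrableOn (fun x => meanCurvature u x * η x * η x) (freeBoundary u)
      (Measure.hausdorffMeasure 1) := by
  have := hu.isFiniteMeasureOnCompacts
  have hK : IsCompact (freeBoundary u ∩ tsupport η) := IsCompact.inter_left hc isClosed_freeBoundary
  have hcont : ContinuousOn (fun x => meanCurvature u x * η x * η x)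
      (freeBoundary u ∩ tsupport η) :=
    ((hu.continuousOn_meanCurvature.mono inter_subset_left).mul hη.continuousOn).mul
      hη.continuousOn
  have h1 := hcont.integrableOn_compact
    (μ := (Measure.hausdorffMeasure 1 : Measure Plane).restrict (freeBoundary u)) hK
  rw [IntegrableOn, Measure.restrict_restrict hK.measurableSet,
    inter_eq_left.2 inter_subset_left] at h1
  refine IntegrableOn.of_forall_sdiff_eq_zero (s := freeBoundary u ∩ tsupport η) h1
    isClosed_freeBoundary.measurableSet fun x hx => ?_
  have : x ∉ tsupport η := fun h => hx.2 ⟨hx.1, h⟩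
  rw [image_eq_zero_of_notMem_tsupport this, mul_zero]

lemma IsClassicalSolution.secondVariation_restrictPhase (hu : IsClassicalSolution u)
    (η : Plane → ℝ) :
    secondVariation u (restrictPhase u η) (restrictPhase u η) =
      (∫ x in posPhase u, ‖gradient η x‖ ^ 2) -
        ∫ x in freeBoundary u, meanCurvature u x * η x * η x ∂(Measure.hausdorffMeasure 1) := by
  rw [secondVariation]
  congr 1
  · refine setIntegral_congr_fun hu.isOpen_posPhase.measurableSet fun x hx => ?_
    simp only [hu.gradient_restrictPhase η hx, real_inner_self_eq_norm_sq]
  · refine setIntegral_congr_fun isClosed_freeBoundary.measurableSet fun x hx => ?_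
    simp only [restrictPhase_of_mem (freeBoundary_subset_closure hx)]

/-- The second variation is diagonal on functions with disjoint supports. -/
lemma IsClassicalSolution.secondVariation_sum (hu : IsClassicalSolution u) {η : ℕ → Plane → ℝ}
    (hη : ∀ i, ContDiff ℝ ∞ (η i)) (hc : ∀ i, HasCompactSupport (η i)) {A : ℕ → Set Plane}
    (hA : ∀ i, IsClosed (A i)) (hηA : ∀ i x, x ∉ A i → η i x = 0)
    (hdisj : ∀ i j, i ≠ j → Disjoint (A i) (A j)) (s : Finset ℕ) (c : ℕ → ℝ) :
    secondVariation u (∑ i ∈ s, c i • restrictPhase u (η i))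
      (∑ i ∈ s, c i • restrictPhase u (η i)) =
      ∑ i ∈ s, c i ^ 2 * secondVariation u (restrictPhase u (η i)) (restrictPhase u (η i)) := by
  have hor : ∀ i j, i ≠ j → ∀ x, x ∉ A i ∨ x ∉ A j := by
    intro i j hij x
    by_contra! h
    exact disjoint_left.1 (hdisj i j hij) h.1 h.2
  simp only [hu.secondVariation_restrictPhase, mul_sub, Finset.sum_sub_distrib]
  rw [secondVariation]
  congr 1
  · simp only [← integral_const_mul]
    rw [← integral_finsetSum s fun i _ =>
      ((integrable_norm_gradient_sq (hη i) (hc i)).integrableOn).const_mul _]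
    refine setIntegral_congr_fun hu.isOpen_posPhase.measurableSet fun x hx => ?_
    have hd : ∀ i, DifferentiableAt ℝ (restrictPhase u (η i)) x := fun i =>
      ((hη i).differentiable (by simp) x).congr_of_eventuallyEq
        (hu.restrictPhase_eventuallyEq (η i) hx)
    simp only [gradient_sum_smul s c hd, hu.gradient_restrictPhase _ hx]
    rw [inner_sum_sum_of_orthogonal]
    · simp only [real_inner_self_eq_norm_sq]
    · intro i j hij
      rcases hor i j hij x with h | h
      · rw [gradient_eq_zero_of_notMem (hA i) (hηA i) h, inner_zero_left]
      · rw [gradient_eq_zero_of_notMem (hA j) (hηA j) h, inner_zero_right]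
  · simp only [← integral_const_mul]
    rw [← integral_finsetSum s fun i _ =>
      (hu.integrableOn_curvature_mul (hη i).continuous (hc i)).const_mul _]
    refine setIntegral_congr_fun isClosed_freeBoundary.measurableSet fun x hx => ?_
    -- The values at `x` are orthogonal vectors of `ℝ`, since at most one of them is nonzero; the
    -- same Pythagoras identity then treats the boundary term.
    have h1 := inner_sum_sum_of_orthogonal s c (fun i => η i x) (by
      intro i j hij
      rcases hor i j hij x with h | h
      · rw [hηA i x h, inner_zero_left]
      · rw [hηA j x h, inner_zero_right])
    simp only [real_inner_self_eq_norm_sq, Real.norm_eq_abs, sq_abs, smul_eq_mul] at h1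
    simp only [Finset.sum_apply, Pi.smul_apply, smul_eq_mul,
      restrictPhase_of_mem (freeBoundary_subset_closure hx)]
    rw [mul_assoc, ← sq, h1, Finset.mul_sum]
    exact Finset.sum_congr rfl fun i _ => by ring

/-- A cutoff whose energy is smaller than the curvature on the set where it equals one is a
direction of negative second variation. -/
lemma IsClassicalSolution.secondVariation_neg (hu : IsClassicalSolution u) {η : Plane → ℝ}
    (hη : ContDiff ℝ ∞ η) (hc : HasCompactSupport η) {A : Set Plane} (hA : MeasurableSet A)
    (hAF : A ⊆ freeBoundary u) (hη1 : ∀ x ∈ A, η x = 1) {c : ℝ}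
    (hcA : ENNReal.ofReal c ≤ ∫⁻ x in A, ENNReal.ofReal (meanCurvature u x)
      ∂(Measure.hausdorffMeasure 1)) (henergy : ∫ x, ‖gradient η x‖ ^ 2 < c) :
    secondVariation u (restrictPhase u η) (restrictPhase u η) < 0 := by
  rw [hu.secondVariation_restrictPhase, sub_neg]
  have h1 : ∫ x in posPhase u, ‖gradient η x‖ ^ 2 ≤ ∫ x, ‖gradient η x‖ ^ 2 :=
    setIntegral_le_integral (integrable_norm_gradient_sq hη hc)
      (Eventually.of_forall fun x => by positivity)
  refine (h1.trans_lt henergy).trans_le ?_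
  have hintgr := hu.integrableOn_curvature_mul hη.continuous hc
  have hnn : ∀ x ∈ freeBoundary u, 0 ≤ meanCurvature u x * η x * η x := fun x hx => by
    rw [mul_assoc]
    exact mul_nonneg (hu.meanCurvature_nonneg hx) (mul_self_nonneg _)
  have hnn' : 0 ≤ᵐ[(Measure.hausdorffMeasure 1 : Measure Plane).restrict (freeBoundary u)]
      fun x => meanCurvature u x * η x * η x :=
    (ae_restrict_iff' isClosed_freeBoundary.measurableSet).2 (Eventually.of_forall hnn)
  -- Nonnegativity of the integrand, that is `H ≥ 0`, allows passing to `lintegral`, where shrinking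
  -- the domain to `A` only lowers the value.
  rw [← ENNReal.ofReal_le_ofReal_iff (setIntegral_nonneg isClosed_freeBoundary.measurableSet hnn),
    ofReal_integral_eq_lintegral_ofReal hintgr hnn']
  refine hcA.trans ?_
  calc ∫⁻ x in A, ENNReal.ofReal (meanCurvature u x) ∂(Measure.hausdorffMeasure 1)
      = ∫⁻ x in A, ENNReal.ofReal (meanCurvature u x * η x * η x)
          ∂(Measure.hausdorffMeasure 1) := by
        refine setLIntegral_congr_fun hA fun x hx => ?_
        simp only [hη1 x hx, mul_one]
    _ ≤ _ := lintegral_mono_set hAF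

/-- A fixed amount of curvature outside of any ball is found in annuli far out. -/
lemma IsClassicalSolution.exists_annulus
    (hinf : ∀ R : ℝ, ENNReal.ofReal (1 / 8) ≤ ∫⁻ x in freeBoundary u \ Metric.closedBall 0 R,
      ENNReal.ofReal (meanCurvature u x) ∂(Measure.hausdorffMeasure 1)) {a : ℝ} (ha : 0 ≤ a) :
    ∃ b, a ≤ b ∧ ENNReal.ofReal (1 / 16) ≤
      ∫⁻ x in freeBoundary u ∩ logNorm ⁻¹' Icc a b, ENNReal.ofReal (meanCurvature u x)
        ∂(Measure.hausdorffMeasure 1) := by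
  set m : Measure Plane := (Measure.hausdorffMeasure 1).withDensity
    fun x => ENNReal.ofReal (meanCurvature u x) with hm
  have hcont : Continuous logNorm := contDiff_logNorm.continuous
  have hmeas : ∀ b, MeasurableSet (freeBoundary u ∩ logNorm ⁻¹' Icc a b) := fun b =>
    (isClosed_freeBoundary.inter (isClosed_Icc.preimage hcont)).measurableSet
  have hmono : Monotone fun n : ℕ => freeBoundary u ∩ logNorm ⁻¹' Icc a (a + n) := by
    intro i j hij
    have : (i : ℝ) ≤ j := by exact_mod_cast hij
    exact inter_subset_inter_right _ (preimage_mono (Icc_subset_Icc_right (by linarith)))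
  have hsub : freeBoundary u \ Metric.closedBall 0 (logRadius a) ⊆
      ⋃ n : ℕ, freeBoundary u ∩ logNorm ⁻¹' Icc a (a + n) := by
    rintro x ⟨hxF, hx⟩
    rw [mem_closedBall_zero_iff, ← logNorm_le_iff ha, not_le] at hx
    obtain ⟨n, hn⟩ := exists_nat_ge (logNorm x - a)
    exact mem_iUnion.2 ⟨n, hxF, hx.le, by linarith⟩
  have hbig : ENNReal.ofReal (1 / 8) ≤
      ⨆ n : ℕ, m (freeBoundary u ∩ logNorm ⁻¹' Icc a (a + n)) := by
    rw [← hmono.measure_iUnion]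
    refine ((hinf (logRadius a)).trans_eq ?_).trans (measure_mono hsub)
    rw [hm, withDensity_apply _
      (isClosed_freeBoundary.measurableSet.diff Metric.isClosed_closedBall.measurableSet)]
  -- The supremum over bounded annuli need not be attained, so a strictly smaller threshold is used.
  have hlt : ENNReal.ofReal (1 / 16) < ENNReal.ofReal (1 / 8) := by
    rw [ENNReal.ofReal_lt_ofReal_iff (by norm_num)]; norm_num
  obtain ⟨n, hn⟩ := lt_iSup_iff.1 (hlt.trans_le hbig)
  refine ⟨a + n, by simp, hn.le.trans_eq ?_⟩
  rw [hm, withDensity_apply _ (hmeas _)]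

/-- Infinitely many boundary components force the index to be infinite. -/
theorem IsClassicalSolution.morseIndex_eq_top (hu : IsClassicalSolution u)
    (hconn : IsConnected (posPhase u)) (hinf : (boundaryComponents u).Infinite) :
    morseIndex u = ⊤ := by
  obtain ⟨K, hK⟩ := exists_energy_bound
  -- Wide enough that the energy `K / L` is below the curvature `1 / 16` found in each annulus.
  set L : ℝ := 16 * |K| + 1 with hLdef
  have hL : 0 < L := by positivity
  have hKL : K / L < 1 / 16 := by
    rw [div_lt_iff₀ hL]
    linarith [le_abs_self K]
  -- The curvature is sought beyond `a + L`, where the cutoff starting at `a` has already reached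
  -- the value one.
  choose! B hB hBc using fun (a : ℝ) (ha : 0 ≤ a) =>
    IsClassicalSolution.exists_annulus (hu.le_lintegral_compl_ball hconn hinf)
      (a := a + L) (by linarith)
  -- Each cutoff ends at `B t + L`; the extra `1` separates the closed annuli.
  let a : ℕ → ℝ := fun n => Nat.rec 0 (fun _ t => B t + L + 1) n
  have ha1 : ∀ n, a (n + 1) = B (a n) + L + 1 := fun n => rfl
  have ha0 : ∀ n, 0 ≤ a n := by
    intro n
    induction n with
    | zero => exact le_rfl
    | succ n ih => rw [ha1]; linarith [hB _ ih]
  have hstep : ∀ n, a n ≤ a (n + 1) := fun n => by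
    rw [ha1]; linarith [hB _ (ha0 n)]
  have hmono : Monotone a := monotone_nat_of_le_succ hstep
  let A : ℕ → Set Plane := fun n => logNorm ⁻¹' Icc (a n) (B (a n) + L)
  let η : ℕ → Plane → ℝ := fun n => logCutoff L (a n) (B (a n))
  have hA : ∀ n, IsClosed (A n) := fun n => isClosed_Icc.preimage contDiff_logNorm.continuous
  have hdisj' : ∀ i j, i < j → Disjoint (A i) (A j) := by
    intro i j hij
    refine disjoint_left.2 fun x hx hx' => ?_
    have h1 : a (i + 1) ≤ a j := hmono hij
    rw [ha1] at h1
    have h2 := hx.2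
    have h3 := hx'.1
    linarith
  have hdisj : ∀ i j, i ≠ j → Disjoint (A i) (A j) := by
    intro i j hij
    rcases hij.lt_or_gt with h | h
    · exact hdisj' i j h
    · exact (hdisj' j i h).symm
  have hη : ∀ n, ContDiff ℝ ∞ (η n) := fun n => contDiff_logCutoff _ _ _
  have hc : ∀ n, HasCompactSupport (η n) := fun n =>
    hasCompactSupport_logCutoff hL (ha0 n) (hB _ (ha0 n))
  have hηA : ∀ n x, x ∉ A n → η n x = 0 := fun n x hx => logCutoff_eq_zero hL (hB _ (ha0 n)) hx
  refine morseIndex_eq_top_of_diagonal (φ := fun n => restrictPhase u (η n))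
    (fun n => restrictPhase_mem_testSpace (hη n) (hc n)) (fun n => ?_)
    (hu.secondVariation_sum hη hc hA hηA hdisj)
  refine hu.secondVariation_neg (hη n) (hc n)
    (A := freeBoundary u ∩ logNorm ⁻¹' Icc (a n + L) (B (a n)))
    (isClosed_freeBoundary.inter
      (isClosed_Icc.preimage contDiff_logNorm.continuous)).measurableSet
    inter_subset_left (fun x hx => logCutoff_eq_one hL hx.2) (c := 1 / 16)
    (hBc _ (ha0 n)) ?_
  exact (hK L (a n) (B (a n)) hL (ha0 n) (hB _ (ha0 n))).trans_lt hKL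

end Index

end OnePhase

end

theorem proposition4p2 (u : OnePhase.Plane → ℝ)
    (hu : OnePhase.IsClassicalSolution u)
    (hconn : IsConnected (OnePhase.posPhase u))
    (hind : OnePhase.morseIndex u < ⊤) :
    OnePhase.HasFiniteTopology u := by
  refine OnePhase.hasFiniteTopology_of_finite ?_
  by_contra hinf
  exact hind.ne (hu.morseIndex_eq_top hconn hinf)
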